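/- **Setting.** Let $K\ge 1$. In the frequency-selective $K$-user Gaussian interference channel with an external eavesdropper $e$, the output of observer $i\in\{1,\dots,K,e\}$ at time $t$ in frequency slot $f$ is $$Y_i(f,t)=\sum_{k=1}^K h_{ik}(f)\,X_k(f,t)+Z_i(f,t),$$ with noise $Z_i(f,t)$ i.i.d. $\mathcal{CN}(0,1)$ over $f,t$. The complex coefficients $h_{ik}(f)$ ($i\in\{1,\dots,K,e\}$, $1\le k\le K$, $f=1,2,\dots$) are random with a continuous distribution (any finitely many of them have a joint law that is absolutely continuous with respect to Lebesgue measure), fixed during the communication, and known everywhere; in particular the eavesdropper's coefficients $h_{ek}(f)$ are known to the network, so codes may depend on all coefficients. **Codes.** Fix a realization of the coefficients and a power $\rho>0$. An $(n,F,M_1,\dots,M_K)$ secret codebook ($n,F,M_k\ge1$) uses $n$ times and the slots $1,\dots,F$. It has independent messages $W_k$, uniform on sets of size $M_k$; stochastic encoders, where encoder $k$ maps $W_k$, using private randomness independent of everything else, to a codeword $(X_k(f,t))_{f\le F,\,t\le n}$ with $\frac1{nF}\sum_{f,t}|X_k(f,t)|^2\le\rho$; and decoders $\phi_k$ of $W_k$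 from $\mathbf Y_k=(Y_k(f,t))_{f\le F,\,t\le n}$. Let $P_{e,k}=\Pr\{\phi_k(\mathbf Y_k)\ne W_k\}$, and for $S\subseteq\{1,\dots,K\}$ let $\Delta_S=H(W_S\mid\mathbf Y_e)/H(W_S)$, with $\Delta_S=1$ if $H(W_S)=0$. The tuple $(R_1,\dots,R_K,d)$ is *achievable* with power $\rho$ if for every $\varepsilon>0$ there is an $(n,F,M_1,\dots,M_K)$ secret codebook with $\frac1{nF}\log_2M_k=R_k$ and $P_{e,k}\le\varepsilon$ for all $k$, and $\Delta_S\ge d-\varepsilon$ for all $S\subseteq\{1,\dots,K\}$. A *secure DoF of $\eta$ per frequency-time slot is achievable for each user* if there are rates $R(\rho)$ such that $(R(\rho),\dots,R(\rho),1)$ is achievable with power $\rho$ for every $\rho>0$, and $\lim_{\rho\to\infty}R(\rho)/\log_2\rho=\eta$. **Corollary.** For almost every realization of the channel coefficients, a secure DoF of $$\eta=\frac{K-1}{2K}$$ per frequency-time slot is achievable for each user. -/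

import Mathlib

open MeasureTheory ProbabilityTheory Filter Topology

noncomputable section

/-- The law `CN(0,1)`: real and imaginary parts are independent `N(0,1/2)`. -/
def stdComplexGaussian : Measure ℂ :=
  ((gaussianReal 0 (1 / 2)).prod (gaussianReal 0 (1 / 2))).map
    (fun p : ℝ × ℝ => (⟨p.1, p.2⟩ : ℂ))

instance stdComplexGaussian_isProbabilityMeasure : IsProbabilityMeasure stdComplexGaussian :=
  Measure.isProbabilityMeasure_map Complex.measurableEquivRealProd.symm.measurable.aemeasurable

/-- Entropy, in bits, of a random variable with values in a finite type. -/
def entropyBits {Ω α : Type*} [MeasurableSpace Ω] [Fintype α] [MeasurableSpace α]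
    (P : Measure Ω) (X : Ω → α) : ℝ :=
  (∑ a, Real.negMulLog ((P.map X).real {a})) / Real.log 2

/-- Conditional entropy `H(X | Y)`, in bits, of a random variable `X` with values in a finite type
given an arbitrary random variable `Y`: the mean over `Y` of the entropy of the conditional law of
`X` given `Y`. -/
def condEntropyBits {Ω α β : Type*} [MeasurableSpace Ω] [Fintype α] [Nonempty α]
    [MeasurableSpace α] [StandardBorelSpace α] [MeasurableSpace β]
    (P : Measure Ω) [IsFiniteMeasure P] (X : Ω → α) (Y : Ω → β) : ℝ :=
  (∫ y, ∑ a, Real.negMulLog ((condDistrib X Y P y).real {a}) ∂(P.map Y)) / Real.log 2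

/-- `n` channel uses over `F` frequency slots; `x t f` is the symbol at time `t`, slot `f`. -/
abbrev Block (n F : ℕ) : Type := Fin n → Fin F → ℂ

/-- The nodes that observe the channel: `some i` is the `i`-th receiver and `none` is the external
eavesdropper. -/
abbrev Observer (K : ℕ) : Type := Option (Fin K)

/-- The coefficients of a frequency-selective channel, constant in time: `h i k f` is the gain
from transmitter `k` to the observer `i` in frequency slot `f`. -/
abbrev Channel (K : ℕ) : Type := Observer K → Fin K → ℕ → ℂ

/-- White noise: independent `CN(0,1)` variables over all times and frequency slots. -/
def noiseLaw (n F : ℕ) : Measure (Block n F) :=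
  Measure.pi fun _ => Measure.pi fun _ => stdComplexGaussian

instance noiseLaw_isProbabilityMeasure (n F : ℕ) : IsProbabilityMeasure (noiseLaw n F) := by
  unfold noiseLaw; infer_instance

/-- What the observer `i` receives when the transmitters send `x` and its noise is `z`. -/
def received {K n F : ℕ} (h : Channel K) (i : Observer K) (x : Fin K → Block n F)
    (z : Block n F) : Block n F :=
  fun t f => (∑ k, h i k f * x k t f) + z t f

/-- A secret codebook of length `n` over `F` frequency slots with average power `ρ`. Encoders may
use private randomness: `enc k w` is the law of the codeword which transmitter `k` sends for the
message `w`. -/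
structure Codebook (K n F : ℕ) (ρ : ℝ) where
  /-- number of messages of each user -/
  M : Fin K → ℕ+
  /-- stochastic encoders -/
  enc : ∀ k, Fin (M k) → Measure (Block n F)
  enc_prob : ∀ k w, IsProbabilityMeasure (enc k w)
  /-- the power constraint, met by every codeword that may be sent -/
  power : ∀ k w, ∀ᵐ x ∂(enc k w), (1 / ((n : ℝ) * F)) * ∑ f, ∑ t, ‖x t f‖ ^ 2 ≤ ρ
  /-- decoders -/
  dec : ∀ k, Block n F → Fin (M k)
  dec_meas : ∀ k, Measurable (dec k)

namespace Codebook

variable {K n F : ℕ} {ρ : ℝ}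

/-- Tuples of messages, one for each user. -/
abbrev Messages (C : Codebook K n F ρ) : Type := ∀ k, Fin (C.M k)

/-- The law of the output at observer `i` when the messages `w` are sent; codewords of different
users and the noise are independent. -/
def outputLaw (C : Codebook K n F ρ) (h : Channel K) (i : Observer K) (w : C.Messages) :
    Measure (Block n F) :=
  ((Measure.pi fun k => C.enc k (w k)).prod (noiseLaw n F)).map
    (fun p => received h i p.1 p.2)

/-- The average error probability `P_{e,k}` at receiver `k`. -/
def errorProb (C : Codebook K n F ρ) (h : Channel K) (k : Fin K) : ℝ :=
  (1 / ∏ j, (C.M j : ℝ)) *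
    ∑ w : C.Messages, (C.outputLaw h (some k) w).real {y | C.dec k y ≠ w k}

theorem outputLaw_isProbabilityMeasure (C : Codebook K n F ρ) (h : Channel K) (i : Observer K)
    (w : C.Messages) : IsProbabilityMeasure (C.outputLaw h i w) := by
  have := fun k => C.enc_prob k (w k)
  refine Measure.isProbabilityMeasure_map (Measurable.aemeasurable ?_)
  unfold received
  fun_prop

/-- The channel from the messages to the output at observer `i`. -/
def outputKernel (C : Codebook K n F ρ) (h : Channel K) (i : Observer K) :
    Kernel C.Messages (Block n F) :=
  Kernel.ofFunOfCountable (C.outputLaw h i)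

instance outputKernel_isMarkovKernel (C : Codebook K n F ρ) (h : Channel K) (i : Observer K) :
    IsMarkovKernel (C.outputKernel h i) :=
  ⟨fun w => C.outputLaw_isProbabilityMeasure h i w⟩

/-- The joint law of the messages, independent and uniform, and the output at observer `i`. -/
def jointLaw (C : Codebook K n F ρ) (h : Channel K) (i : Observer K) :
    Measure (C.Messages × Block n F) :=
  (uniformOn (Set.univ : Set C.Messages)) ⊗ₘ (C.outputKernel h i)

instance jointLaw_isProbabilityMeasure (C : Codebook K n F ρ) (h : Channel K) (i : Observer K) :
    IsProbabilityMeasure (C.jointLaw h i) := by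
  have : IsProbabilityMeasure (uniformOn (Set.univ : Set C.Messages)) :=
    isProbabilityMeasure_uniformOn Set.finite_univ Set.univ_nonempty
  unfold jointLaw
  infer_instance

/-- The messages `W_S` of the users in `S`, as a random variable. -/
def messagesOf (C : Codebook K n F ρ) (S : Finset (Fin K)) (ω : C.Messages × Block n F) :
    ∀ k : S, Fin (C.M k) :=
  fun k => ω.1 k

/-- The normalized equivocation `H(W_S | Y_e) / H(W_S)` of the messages of the users in `S` at the
eavesdropper, with value `1` if `H(W_S) = 0` (there is nothing to hide). -/
def equivocation (C : Codebook K n F ρ) (h : Channel K) (S : Finset (Fin K)) : ℝ :=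
  open scoped Classical in
  if entropyBits (C.jointLaw h none) (C.messagesOf S) = 0 then 1
  else condEntropyBits (C.jointLaw h none) (C.messagesOf S) Prod.snd /
    entropyBits (C.jointLaw h none) (C.messagesOf S)

end Codebook

/-- The rate-equivocation tuple `(R₁, …, R_K, d)` is achievable with power `ρ` over the channel
`h` with an external eavesdropper. The whole channel, eavesdropper included, is known when the
code is chosen. -/
def RateEquivocationAchievable {K : ℕ} (h : Channel K) (ρ : ℝ) (R : Fin K → ℝ) (d : ℝ) : Prop :=
  ∀ ε : ℝ, 0 < ε → ∃ n F : ℕ, 0 < n ∧ 0 < F ∧ ∃ C : Codebook K n F ρ,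
    (∀ k, (1 / ((n : ℝ) * F)) * Real.logb 2 (C.M k) = R k) ∧
    (∀ k, C.errorProb h k ≤ ε) ∧
    (∀ S : Finset (Fin K), d - ε ≤ C.equivocation h S)

/-- The symmetric degrees of freedom `η` per frequency-time slot is achievable with perfect
secrecy over the channel `h`. -/
def SecureDoFAchievable {K : ℕ} (h : Channel K) (η : ℝ) : Prop :=
  ∃ R : ℝ → ℝ, (∀ ρ : ℝ, 0 < ρ → RateEquivocationAchievable h ρ (fun _ => R ρ) 1) ∧
    Tendsto (fun ρ => R ρ / Real.logb 2 ρ) atTop (𝓝 η)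

end

/-!
The scheme combines asymptotic interference alignment with jamming transmitters that take turns.

*Alignment.* Over many frequency slots, all transmitters use as directions monomials in the gains
of the links other than the direct ones: data use exponents in `1, …, N`, jamming uses exponents
in `0, …, N + 1`. Multiplication by a gain shifts one exponent by one, so that at each receiver
all interference lies in the span of the monomials with exponents at most `N + 2`, while the
desired data carry an additional direct gain. Together these monomials are as many as there are
slots, and they are almost surely a basis: their determinant is a polynomial in the gains that is
not zero, as it becomes a Vandermonde determinant for gains that are powers of distinct primes. At
the eavesdropper, the data of each user fall on the jamming directions of the user whose turn it
is to jam (`ae_exists_alignment`). Data directions fill half of the slots as `N` grows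
(`tendsto_card_div_slots`), and each user sends data at the fraction `(K - 1) / K` of the times;
hence the value `(K - 1) / (2 * K)`.

*Reliability.* Symbols are Gaussian integers in a grid whose spacing after scaling grows with the
power, so that symbolwise decisions after zero forcing are wrong with small probability. A random
code with bounded distance decoding corrects the wrong ones (`errorProb_jamCodebook_le`).

*Secrecy.* The eavesdropper observes in noise the sum of the symbols of the jammer and the data
symbols aligned with them. By the chain rule it is enough that the message of each single user is
hidden from an eavesdropper without noise that knows the data of all others
(`card_mul_le_finCondEntropy`). For such an eavesdropper the sum of a data symbol and a jamming
symbol reveals a bounded number of bits per symbol, whatever the size of the grid; a code with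
that many random words per message hides the message up to a bounded number of bits, at no cost in
degrees of freedom. The same random code serves both purposes (`exists_secret_code`). The
entropies at the Gaussian channel are compared with those of the finite data by concavity of
entropy (`finCondEntropy_le_condEntropyBits`), so no property of the noise law is used except that
it is a probability measure.
-/

set_option linter.unusedSectionVars false

/-! ### Generic invertibility of matrices of monomials, and interference alignment -/

/-- The zero set of a nonzero complex polynomial is a null set: by Fubini, since for almost every
value of the other coordinates a leading coefficient does not vanish and there are finitely many
roots in the first coordinate. -/
theorem MvPolynomial.volume_eval_eq_zero_fin (n : ℕ) (p : MvPolynomial (Fin n) ℂ) (hp : p ≠ 0) :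
    volume {x : Fin n → ℂ | MvPolynomial.eval x p = 0} = 0 := by
  induction n with
  | zero =>
    have : {x : Fin 0 → ℂ | MvPolynomial.eval x p = 0} = ∅ := by
      ext x
      simp only [Set.mem_ofPred_eq, Set.mem_empty_iff_false, iff_false]
      rw [MvPolynomial.eq_C_of_isEmpty p] at hp ⊢
      simpa using hp
    rw [this, measure_empty]
  | succ n ih =>
    have hcont : Continuous fun x : Fin (n + 1) → ℂ => MvPolynomial.eval x p :=
      MvPolynomial.continuous_eval p
    have hq : MvPolynomial.finSuccEquiv ℂ n p ≠ 0 := by simpa using hp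
    obtain ⟨d, hd⟩ : ∃ d, (MvPolynomial.finSuccEquiv ℂ n p).coeff d ≠ 0 := by
      by_contra! hcon
      exact hq (Polynomial.ext fun d => by simpa using hcon d)
    have hmp := (volume_preserving_piFinSuccAbove (fun _ : Fin (n + 1) => ℂ) 0).symm
    have hmeas : MeasurableSet {x : Fin (n + 1) → ℂ | MvPolynomial.eval x p = 0} :=
      (isClosed_singleton.preimage hcont).measurableSet
    rw [← hmp.measure_preimage hmeas.nullMeasurableSet]
    change (volume.prod volume) _ = 0
    have hm2 := hmp.measurable hmeas
    have hsw := (Measure.measurePreserving_swap (μ := (volume : Measure (Fin n → ℂ)))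
      (ν := (volume : Measure ℂ)))
    rw [← hsw.measure_preimage hm2.nullMeasurableSet,
      Measure.measure_prod_null (hsw.measurable hm2)]
    filter_upwards [compl_mem_ae_iff.mpr (ih _ hd)] with y hy
    -- for such `y` the polynomial in the first coordinate is nonzero, so has finitely many roots
    have hne : (MvPolynomial.finSuccEquiv ℂ n p).map (MvPolynomial.eval y) ≠ 0 := by
      intro h0
      apply hy
      have := congrArg (fun q => Polynomial.coeff q d) h0
      simpa [Polynomial.coeff_map] using this
    refine measure_mono_null ?_ ((Polynomial.finite_setOfPred_isRoot hne).measure_zero volume)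
    intro x hx
    simp only [Set.mem_preimage, Set.mem_ofPred_eq, Prod.swap] at hx ⊢
    have h1 : MvPolynomial.eval (Fin.cons x y : Fin (n + 1) → ℂ) p = 0 := by
      simpa [MeasurableEquiv.piFinSuccAbove, Fin.consEquiv] using hx
    rw [Polynomial.IsRoot.def, ← MvPolynomial.eval_eq_eval_mv_eval' y x p, h1]

theorem MvPolynomial.volume_eval_eq_zero {σ : Type*} [Fintype σ] (p : MvPolynomial σ ℂ)
    (hp : p ≠ 0) : volume {x : σ → ℂ | MvPolynomial.eval x p = 0} = 0 := by
  let e := Fintype.equivFin σ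
  have hmp := volume_measurePreserving_piCongrLeft (fun _ : Fin (Fintype.card σ) => ℂ) e
  have hq : MvPolynomial.rename e p ≠ 0 := by
    intro h
    exact hp (MvPolynomial.rename_injective e e.injective (by simpa using h))
  have h := MvPolynomial.volume_eval_eq_zero_fin _ _ hq
  have hmeas : MeasurableSet
      {x : Fin (Fintype.card σ) → ℂ | MvPolynomial.eval x (MvPolynomial.rename e p) = 0} :=
    (isClosed_singleton.preimage (MvPolynomial.continuous_eval _)).measurableSet
  rw [← hmp.measure_preimage hmeas.nullMeasurableSet] at h
  convert h using 2
  ext x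
  simp only [Set.mem_ofPred_eq, Set.mem_preimage, MvPolynomial.eval_rename]
  have : (MeasurableEquiv.piCongrLeft (fun _ : Fin (Fintype.card σ) => ℂ) e x) ∘ e = x := by
    funext i
    exact Equiv.piCongrLeft_apply_apply (fun _ : Fin (Fintype.card σ) => ℂ) e x i
  rw [this]

section Alignment

variable {K : ℕ}

/-- The value in slot `f` of the monomial `∏ h_{ik}^{E(i,k)}` in the channel gains. -/
def gainMonomial (h : Channel K) (E : Observer K × Fin K → ℕ) (f : ℕ) : ℂ :=
  ∏ q, h q.1 q.2 f ^ E q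

theorem mul_gainMonomial (h : Channel K) (E : Observer K × Fin K → ℕ) (f : ℕ) (i : Observer K)
    (k : Fin K) :
    h i k f * gainMonomial h E f = gainMonomial h (E + Pi.single (i, k) 1) f := by
  classical
  unfold gainMonomial
  simp only [Pi.add_apply, pow_add, Finset.prod_mul_distrib]
  rw [mul_comm]
  congr 1
  rw [Finset.prod_eq_single (i, k)]
  · simp
  · intro b _ hb
    simp [Pi.single_eq_of_ne hb]
  · simp

theorem injective_prod_primes_pow {ι : Type*} [Fintype ι] (p : ι → ℕ) (hp : ∀ i, (p i).Prime)
    (hinj : Function.Injective p) :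
    Function.Injective fun E : ι → ℕ => ∏ i, p i ^ E i := by
  classical
  intro E E' h
  have key : ∀ (E : ι → ℕ) (i : ι), (∏ j, p j ^ E j).factorization (p i) = E i := by
    intro E i
    rw [Nat.factorization_prod fun j _ => pow_ne_zero _ (hp j).ne_zero]
    simp only [Finsupp.finsetSum_apply, (hp _).factorization_pow]
    rw [Finset.sum_eq_single i]
    · simp
    · intro j _ hj
      rw [Finsupp.single_eq_of_ne]
      exact fun h => hj (hinj h).symm
    · simp
  funext i
  rw [← key E i, ← key E' i]
  exact congrArg (fun a : ℕ => a.factorization (p i)) h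

/-- The determinant of a matrix of distinct monomials, one slot per row, does not vanish
identically. -/
theorem exists_channel_det_gainMonomial_ne_zero {F : ℕ} (E : Fin F → Observer K × Fin K → ℕ)
    (hE : Function.Injective E) :
    ∃ h : Channel K, (Matrix.of fun f j : Fin F => gainMonomial h (E j) f).det ≠ 0 := by
  let e := Fintype.equivFin (Observer K × Fin K)
  let p : Observer K × Fin K → ℕ := fun q => Nat.nth Nat.Prime (e q)
  have hp : ∀ q, (p q).Prime := fun q => Nat.prime_nth_prime _
  have hpinj : Function.Injective p := fun a b hab =>
    e.injective (Fin.ext (Nat.nth_injective Nat.infinite_setOfPred_prime hab))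
  refine ⟨fun i k f => (p (i, k) : ℂ) ^ f, ?_⟩
  -- with gains `p_q ^ f` at distinct primes `p_q` the matrix is a Vandermonde matrix
  have : (Matrix.of fun f j : Fin F => gainMonomial
      (fun i k f => (p (i, k) : ℂ) ^ f : Channel K) (E j) f) =
      (Matrix.vandermonde fun j => ((∏ q, p q ^ E j q : ℕ) : ℂ)).transpose := by
    ext f j
    simp only [gainMonomial, Matrix.of_apply, Matrix.transpose_apply, Matrix.vandermonde_apply,
      Nat.cast_prod, Nat.cast_pow, ← Finset.prod_pow]
    refine Finset.prod_congr rfl fun q _ => ?_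
    rw [← pow_mul, ← pow_mul, mul_comm]
  rw [this, Matrix.det_transpose, Matrix.det_vandermonde_ne_zero_iff]
  intro a b hab
  exact hE (injective_prod_primes_pow p hp hpinj (Nat.cast_injective (R := ℂ) hab))

theorem ae_det_gainMonomial_ne_zero {Ω : Type*} [MeasurableSpace Ω] (P : Measure Ω)
    (h : Ω → Channel K) (h_meas : ∀ i k f, Measurable fun ω => h ω i k f)
    (h_cont : ∀ T : Finset (Observer K × Fin K × ℕ),
      P.map (fun ω (a : T) => h ω a.1.1 a.1.2.1 a.1.2.2) ≪ (volume : Measure (T → ℂ)))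
    {F : ℕ} (E : Fin F → Observer K × Fin K → ℕ) (hE : Function.Injective E) :
    ∀ᵐ ω ∂P, (Matrix.of fun f j : Fin F => gainMonomial (h ω) (E j) f).det ≠ 0 := by
  classical
  let T : Finset (Observer K × Fin K × ℕ) :=
    Finset.univ ×ˢ Finset.univ ×ˢ Finset.range F
  have hT : ∀ (q : Observer K × Fin K) (f : Fin F), (q.1, q.2, (f : ℕ)) ∈ T := by
    intro q f
    simp [T]
  let A : Matrix (Fin F) (Fin F) (MvPolynomial T ℂ) :=
    Matrix.of fun f j => ∏ q, MvPolynomial.X ⟨(q.1, q.2, (f : ℕ)), hT q f⟩ ^ E j q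
  have heval : ∀ g : Channel K,
      MvPolynomial.eval (fun a : T => g a.1.1 a.1.2.1 a.1.2.2) A.det =
        (Matrix.of fun f j : Fin F => gainMonomial g (E j) f).det := by
    intro g
    rw [RingHom.map_det]
    congr 1
    ext f j
    simp [A, gainMonomial]
  have hne : A.det ≠ 0 := by
    obtain ⟨g, hg⟩ := exists_channel_det_gainMonomial_ne_zero E hE
    intro h0
    rw [← heval g, h0, map_zero] at hg
    exact hg rfl
  have hnull := h_cont T (MvPolynomial.volume_eval_eq_zero _ hne)
  have hmeas : Measurable fun ω (a : T) => h ω a.1.1 a.1.2.1 a.1.2.2 :=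
    measurable_pi_lambda _ fun a => h_meas _ _ _
  have hclosed : IsClosed {x : T → ℂ | MvPolynomial.eval x A.det = 0} :=
    isClosed_singleton.preimage (MvPolynomial.continuous_eval _)
  rw [Measure.map_apply hmeas hclosed.measurableSet] at hnull
  rw [ae_iff]
  convert hnull using 2
  ext ω
  simp only [Set.mem_ofPred_eq, Set.mem_preimage, not_not, heval]

/-- Interference alignment over `F` frequency slots. All transmitters modulate their data symbols
on the same directions `dir` and their jamming symbols on the same directions `jamDir`. A receiver
separates the data of its own transmitter from everything that the other transmitters send, while
at the eavesdropper the data of one transmitter fall on the jamming directions of another one. -/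
structure InterferenceAlignment (h : Channel K) (F : ℕ) (V J : Type) [DecidableEq V] where
  /-- directions of the data symbols -/
  dir : V → Fin F → ℂ
  /-- directions of the jamming symbols -/
  jamDir : J → Fin F → ℂ
  /-- the zero-forcing functional with which receiver `i` extracts its data symbol `m` -/
  proj : Fin K → V → ((Fin F → ℂ) →ₗ[ℂ] ℂ)
  proj_desired : ∀ i m m',
    proj i m (fun f => h (some i) i f * dir m' f) = if m = m' then 1 else 0
  proj_dir : ∀ i k, k ≠ i → ∀ m m', proj i m (fun f => h (some i) k f * dir m' f) = 0
  proj_jamDir : ∀ i k, k ≠ i → ∀ m m', proj i m (fun f => h (some i) k f * jamDir m' f) = 0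
  /-- `shift k j m` is the jamming direction of transmitter `j` that hides the data direction `m` of
  transmitter `k` from the eavesdropper -/
  shift : Fin K → Fin K → V → J
  shift_injective : ∀ k j, k ≠ j → Function.Injective (shift k j)
  dir_eq_jamDir : ∀ k j, k ≠ j → ∀ m (f : Fin F),
    h none k f * dir m f = h none j f * jamDir (shift k j m) f

/-- The links that carry interference or leak to the eavesdropper: all but the direct ones. -/
abbrev CrossLink (K : ℕ) : Type := {q : Observer K × Fin K // q.1 ≠ some q.2}

open scoped Classical in
/-- Extension of an exponent vector by zero to the direct links. -/
def linkExponent (e : CrossLink K → ℕ) (q : Observer K × Fin K) : ℕ :=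
  if hq : q.1 ≠ some q.2 then e ⟨q, hq⟩ else 0

theorem linkExponent_injective : Function.Injective (linkExponent (K := K)) := by
  intro e e' h
  funext q
  have := congrFun h q.1
  simpa [linkExponent, q.2] using this

theorem linkExponent_direct (e : CrossLink K → ℕ) (i : Fin K) :
    linkExponent e (some i, i) = 0 := by
  simp [linkExponent]

open scoped Classical in
theorem linkExponent_add_single (e : CrossLink K → ℕ) (q : CrossLink K) :
    linkExponent e + Pi.single q.1 1 = linkExponent (e + Pi.single q 1) := by
  funext r
  by_cases hr : r.1 ≠ some r.2
  · by_cases hrq : r = q.1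
    · subst hrq
      simp [linkExponent, q.2]
    · have : (⟨r, hr⟩ : CrossLink K) ≠ q := fun h => hrq (congrArg Subtype.val h)
      simp [linkExponent, hr, Pi.single_eq_of_ne hrq, Pi.single_eq_of_ne this]
  · have : r ≠ q.1 := by rintro rfl; exact hr q.2
    simp [linkExponent, hr, Pi.single_eq_of_ne this]

/-- Exponents of the monomials in the space of receiver `i`. The first kind are the data directions,
with cross-link exponents in `1, …, N`, multiplied by the direct gain; the second kind span all the
interference, whose exponents are at most `N + 2` once a cross gain has been multiplied to a data or
jamming direction. The direct gain occurs in the first kind only, so all of them are distinct. -/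
def receiverExponent (N : ℕ) (i : Fin K) :
    (CrossLink K → Fin N) ⊕ (CrossLink K → Fin (N + 3)) → Observer K × Fin K → ℕ
  | .inl m => linkExponent (fun q => m q + 1) + Pi.single (some i, i) 1
  | .inr m => linkExponent fun q => m q

theorem receiverExponent_injective (N : ℕ) (i : Fin K) :
    Function.Injective (receiverExponent N i) := by
  have hval : ∀ {n : ℕ} (m m' : CrossLink K → Fin n),
      (fun q => (m q : ℕ)) = (fun q => (m' q : ℕ)) → m = m' := fun m m' h =>
    funext fun q => Fin.ext (congrFun h q)
  rintro (m | m) (m' | m') h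
  · have h1 := linkExponent_injective (add_right_cancel h)
    congr 1
    exact hval _ _ (funext fun q => by simpa using congrFun h1 q)
  · have := congrFun h (some i, i)
    simp [receiverExponent, linkExponent_direct] at this
  · have := congrFun h (some i, i)
    simp [receiverExponent, linkExponent_direct] at this
  · rw [hval _ _ (linkExponent_injective h)]

/-- The number of frequency slots in which the spaces of desired signals and of interference fill
the space of a receiver. -/
def slots (K N : ℕ) : ℕ :=
  Fintype.card ((CrossLink K → Fin N) ⊕ (CrossLink K → Fin (N + 3)))

/-- An enumeration of the monomials of a receiver, which makes their matrix square. -/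
noncomputable def slotEquiv (K N : ℕ) :
    (CrossLink K → Fin N) ⊕ (CrossLink K → Fin (N + 3)) ≃ Fin (slots K N) :=
  Fintype.equivFin _

theorem exists_basis_of_det_ne_zero {X : Type*} {F : ℕ} (φ : X → Fin F → ℂ) (e : X ≃ Fin F)
    (hdet : (Matrix.of fun f j : Fin F => φ (e.symm j) f).det ≠ 0) :
    ∃ b : Module.Basis X ℂ (Fin F → ℂ), ∀ x, b x = φ x := by
  have hli := Matrix.linearIndependent_cols_of_det_ne_zero hdet
  have hspan := hli.span_eq_top_of_card_eq_finrank' (by simp)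
  refine ⟨(Module.Basis.mk hli hspan.symm.le).reindex e.symm, fun x => ?_⟩
  funext f
  simp [Module.Basis.reindex_apply]

/-- Alignment by monomials: the data directions have cross-link exponents in `1, …, N` and the
jamming directions in `0, …, N + 1`. The dual basis of the monomials at a receiver gives its
zero-forcing functionals. Moving a data direction from the link of `k` to that of `j` at the
eavesdropper raises one exponent and lowers another by one, and so yields a jamming direction. -/
theorem exists_alignment (h : Channel K) (N : ℕ)
    (hdet : ∀ i, (Matrix.of fun f j : Fin (slots K N) =>
      gainMonomial h (receiverExponent N i ((slotEquiv K N).symm j)) f).det ≠ 0) :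
    Nonempty (InterferenceAlignment h (slots K N) (CrossLink K → Fin N)
      (CrossLink K → Fin (N + 2))) := by
  classical
  have hex := fun i => exists_basis_of_det_ne_zero
    (fun x (f : Fin (slots K N)) => gainMonomial h (receiverExponent N i x) f)
    (slotEquiv K N) (hdet i)
  choose b hb using hex
  -- an aligned direction, scaled by a cross gain, stays among the interference monomials
  have hint : ∀ (i k : Fin K), k ≠ i → ∀ (e : CrossLink K → ℕ), (∀ q, e q < N + 2) →
      ∀ m, (b i).coord (.inl m)
        (fun f => h (some i) k f * gainMonomial h (linkExponent e) f) = 0 := by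
    intro i k hk e he m
    have hq : ((some i, k) : Observer K × Fin K).1 ≠ some ((some i, k) : Observer K × Fin K).2 := by
      simpa using fun h => hk h.symm
    let q : CrossLink K := ⟨(some i, k), hq⟩
    have hlt : ∀ r, (e + (Pi.single q 1 : CrossLink K → ℕ)) r < N + 3 := by
      intro r
      have h1 : (Pi.single q 1 : CrossLink K → ℕ) r ≤ 1 := by
        rw [Pi.single_apply]; split_ifs <;> simp
      have := he r
      simp only [Pi.add_apply]
      omega
    have : (fun f : Fin (slots K N) => h (some i) k f * gainMonomial h (linkExponent e) f) =
        b i (.inr fun r => ⟨_, hlt r⟩) := by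
      rw [hb]
      funext f
      rw [mul_gainMonomial, linkExponent_add_single e q]
      rfl
    rw [this]
    simp
  -- the truncated subtraction is exact, since data directions have exponents at least one
  have hshift : ∀ (k j : Fin K) (m : CrossLink K → Fin N) (r : CrossLink K),
      m r + 1 + (Pi.single (⟨(none, k), by simp⟩ : CrossLink K) 1 : CrossLink K → ℕ) r
        - (Pi.single (⟨(none, j), by simp⟩ : CrossLink K) 1 : CrossLink K → ℕ) r < N + 2 := by
    intro k j m r
    have h1 : (Pi.single (⟨(none, k), by simp⟩ : CrossLink K) 1 : CrossLink K → ℕ) r ≤ 1 := by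
      rw [Pi.single_apply]; split_ifs <;> simp
    have := (m r).2
    omega
  have hle : ∀ (j : Fin K) (r : CrossLink K),
      (Pi.single (⟨(none, j), by simp⟩ : CrossLink K) 1 : CrossLink K → ℕ) r ≤ 1 := by
    intro j r
    rw [Pi.single_apply]; split_ifs <;> simp
  let dir : (CrossLink K → Fin N) → Fin (slots K N) → ℂ :=
    fun m f => gainMonomial h (linkExponent fun q => m q + 1) f
  let jamDir : (CrossLink K → Fin (N + 2)) → Fin (slots K N) → ℂ :=
    fun m f => gainMonomial h (linkExponent fun q => m q) f
  have h1 : ∀ (i : Fin K) (m m' : CrossLink K → Fin N),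
      (b i).coord (.inl m) (fun f => h (some i) i f * dir m' f) = if m = m' then 1 else 0 := by
    intro i m m'
    have : (fun f : Fin (slots K N) => h (some i) i f * dir m' f) = b i (.inl m') := by
      rw [hb]
      funext f
      exact mul_gainMonomial _ _ _ _ _
    rw [this]
    simp [Finsupp.single_apply, eq_comm]
  have h2 : ∀ (k j : Fin K) (m : CrossLink K → Fin N) (f : Fin (slots K N)),
      h none k f * dir m f = h none j f * jamDir (fun r => ⟨_, hshift k j m r⟩) f := by
    intro k j m f
    simp only [dir, jamDir]
    rw [mul_gainMonomial, mul_gainMonomial,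
      linkExponent_add_single _ (⟨(none, k), by simp⟩ : CrossLink K),
      linkExponent_add_single _ (⟨(none, j), by simp⟩ : CrossLink K)]
    congr 2
    funext r
    have := hle j r
    simp only [Pi.add_apply]
    omega
  have h3 : ∀ (k j : Fin K), Function.Injective
      fun (m : CrossLink K → Fin N) (r : CrossLink K) => (⟨_, hshift k j m r⟩ : Fin (N + 2)) := by
    intro k j m m' hm
    funext r
    have := congrArg Fin.val (congrFun hm r)
    simp only at this
    have := hle j r
    exact Fin.ext (by omega)
  have h4 : ∀ (i k : Fin K), k ≠ i → ∀ (m m' : CrossLink K → Fin N),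
      (b i).coord (.inl m) (fun f => h (some i) k f * dir m' f) = 0 := fun i k hk m m' =>
    hint i k hk (fun q => m' q + 1) (fun q => by have := (m' q).2; omega) m
  have h5 : ∀ (i k : Fin K), k ≠ i → ∀ (m : CrossLink K → Fin N) (m' : CrossLink K → Fin (N + 2)),
      (b i).coord (.inl m) (fun f => h (some i) k f * jamDir m' f) = 0 := fun i k hk m m' =>
    hint i k hk (fun q => m' q) (fun q => (m' q).2) m
  exact ⟨⟨dir, jamDir, fun i m => (b i).coord (.inl m), h1, h4, h5,
    fun k j m r => ⟨_, hshift k j m r⟩, fun k j _ => h3 k j, fun k j _ => h2 k j⟩⟩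

theorem ae_exists_alignment {Ω : Type*} [MeasurableSpace Ω] (P : Measure Ω)
    (h : Ω → Channel K) (h_meas : ∀ i k f, Measurable fun ω => h ω i k f)
    (h_cont : ∀ T : Finset (Observer K × Fin K × ℕ),
      P.map (fun ω (a : T) => h ω a.1.1 a.1.2.1 a.1.2.2) ≪ (volume : Measure (T → ℂ))) :
    ∀ᵐ ω ∂P, ∀ N : ℕ, Nonempty (InterferenceAlignment (h ω) (slots K N)
      (CrossLink K → Fin N) (CrossLink K → Fin (N + 2))) := by
  rw [ae_all_iff]
  intro N
  have : ∀ᵐ ω ∂P, ∀ i, (Matrix.of fun f j : Fin (slots K N) =>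
      gainMonomial (h ω) (receiverExponent N i ((slotEquiv K N).symm j)) f).det ≠ 0 := by
    rw [ae_all_iff]
    intro i
    exact ae_det_gainMonomial_ne_zero P h h_meas h_cont _
      ((receiverExponent_injective N i).comp (Equiv.injective _))
  filter_upwards [this] with ω hω
  exact exists_alignment (h ω) N hω

end Alignment

/-! ### Conditional entropy of functions on a finite uniform space -/

section FiniteEntropy

open scoped Classical

variable {Ω α β γ : Type*} [Fintype Ω]

/-- The number of points in the fibre of `f` through `ω`. -/
noncomputable def fiberCard (f : Ω → α) (ω : Ω) : ℕ :=
  (Finset.univ.filter fun ω' => f ω' = f ω).card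

theorem fiberCard_pos (f : Ω → α) (ω : Ω) : 0 < fiberCard f ω :=
  Finset.card_pos.mpr ⟨ω, by simp⟩

theorem fiberCard_congr {f : Ω → α} {g : Ω → β} (h : ∀ ω ω', f ω' = f ω ↔ g ω' = g ω) (ω : Ω) :
    fiberCard f ω = fiberCard g ω := by
  unfold fiberCard
  congr 1
  ext ω'
  simp [h]

theorem fiberCard_eq {f : Ω → α} {ω ω' : Ω} (h : f ω = f ω') : fiberCard f ω = fiberCard f ω' := by
  unfold fiberCard
  rw [h]

theorem fiberCard_eq_sum [DecidableEq α] (f : Ω → α) (ω : Ω) :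
    (fiberCard f ω : ℝ) = ∑ ω', if f ω' = f ω then 1 else 0 := by
  rw [Finset.sum_boole]
  unfold fiberCard
  congr!

theorem fiberCard_comp_equiv {Ω' : Type*} [Fintype Ω'] (e : Ω' ≃ Ω) (f : Ω → α) (ω : Ω') :
    fiberCard (fun ω => f (e ω)) ω = fiberCard f (e ω) := by
  unfold fiberCard
  refine Finset.card_equiv e fun ω' => ?_
  simp

theorem fiberCard_prod {Ω' : Type*} [Fintype Ω'] (f : Ω → α) (ω : Ω × Ω') :
    fiberCard (fun ω : Ω × Ω' => (f ω.1, ω.2)) ω = fiberCard f ω.1 := by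
  unfold fiberCard
  refine Finset.card_bij (fun ω' _ => ω'.1) ?_ ?_ ?_
  · intro ω' h
    simp only [Finset.mem_filter, Finset.mem_univ, true_and, Prod.mk.injEq] at h ⊢
    exact h.1
  · intro a ha b hb hab
    simp only [Finset.mem_filter, Finset.mem_univ, true_and, Prod.mk.injEq] at ha hb
    exact Prod.ext hab (ha.2.trans hb.2.symm)
  · intro b hb
    exact ⟨(b, ω.2), by simpa using hb, rfl⟩

/-- The conditional entropy `H(f | g)`, in nats, of functions on a finite probability space with
the uniform measure. -/
noncomputable def finCondEntropy (f : Ω → α) (g : Ω → β) : ℝ :=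
  (∑ ω, Real.log (fiberCard g ω / fiberCard (fun ω => (f ω, g ω)) ω)) / Fintype.card Ω

theorem finCondEntropy_congr {α' β' : Type*} {f : Ω → α} {g : Ω → β} {f' : Ω → α'} {g' : Ω → β'}
    (hg : ∀ ω ω', g ω' = g ω ↔ g' ω' = g' ω)
    (hf : ∀ ω ω', g ω' = g ω → (f ω' = f ω ↔ f' ω' = f' ω)) :
    finCondEntropy f g = finCondEntropy f' g' := by
  unfold finCondEntropy
  congr 1
  refine Finset.sum_congr rfl fun ω _ => ?_
  rw [fiberCard_congr hg, fiberCard_congr (f := fun ω => (f ω, g ω))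
    (g := fun ω => (f' ω, g' ω))]
  intro ω ω'
  simp only [Prod.mk.injEq, ← hg ω ω']
  constructor
  · rintro ⟨h1, h2⟩
    exact ⟨(hf _ _ h2).mp h1, h2⟩
  · rintro ⟨h1, h2⟩
    exact ⟨(hf _ _ h2).mpr h1, h2⟩

/-- The chain rule. -/
theorem finCondEntropy_prodMk (f : Ω → α) (f' : Ω → γ) (g : Ω → β) :
    finCondEntropy (fun ω => (f ω, f' ω)) g =
      finCondEntropy f g + finCondEntropy f' (fun ω => (f ω, g ω)) := by
  unfold finCondEntropy
  rw [← add_div, ← Finset.sum_add_distrib]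
  congr 1
  refine Finset.sum_congr rfl fun ω _ => ?_
  have h1 := fiberCard_pos g ω
  have h2 := fiberCard_pos (fun ω => (f ω, g ω)) ω
  have h3 := fiberCard_pos (fun ω => (f' ω, (f ω, g ω))) ω
  have h4 : fiberCard (fun ω => ((f ω, f' ω), g ω)) ω =
      fiberCard (fun ω => (f' ω, (f ω, g ω))) ω :=
    fiberCard_congr (fun ω ω' => by simp only [Prod.mk.injEq]; tauto) ω
  rw [h4, ← Real.log_mul (by positivity) (by positivity)]
  congr 1
  field_simp

/-- Conditioning on more reduces entropy. The hypothesis says that `g` is a function of `g'`. -/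
theorem finCondEntropy_anti [Nonempty Ω] (f : Ω → α) {g : Ω → β} {g' : Ω → γ}
    (h : ∀ ω ω', g' ω' = g' ω → g ω' = g ω) :
    finCondEntropy f g' ≤ finCondEntropy f g := by
  unfold finCondEntropy
  gcongr ?_ / _
  set A := fiberCard g
  set B := fiberCard (fun ω => (f ω, g ω))
  set A' := fiberCard g'
  set B' := fiberCard (fun ω => (f ω, g' ω))
  have hA : ∀ ω, (0 : ℝ) < A ω := fun ω => by exact_mod_cast fiberCard_pos _ ω
  have hB : ∀ ω, (0 : ℝ) < B ω := fun ω => by exact_mod_cast fiberCard_pos _ ω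
  have hA' : ∀ ω, (0 : ℝ) < A' ω := fun ω => by exact_mod_cast fiberCard_pos _ ω
  have hB' : ∀ ω, (0 : ℝ) < B' ω := fun ω => by exact_mod_cast fiberCard_pos _ ω
  -- as `log x ≤ x - 1`, it is enough that the mean of the ratio of the two quotients is at most one
  have hlog : ∀ ω, Real.log (A' ω / B' ω) ≤
      Real.log (A ω / B ω) + ((B ω * A' ω) / (A ω * B' ω) - 1) := by
    intro ω
    have h1 := Real.log_le_sub_one_of_pos
      (show (0 : ℝ) < (B ω * A' ω) / (A ω * B' ω) by
        have := hA ω; have := hB ω; have := hA' ω; have := hB' ω; positivity)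
    have h2 : Real.log (A' ω / B' ω) =
        Real.log (A ω / B ω) + Real.log ((B ω * A' ω) / (A ω * B' ω)) := by
      have := hA ω; have := hB ω; have := hA' ω; have := hB' ω
      rw [← Real.log_mul (by positivity) (by positivity)]
      congr 1
      field_simp
    linarith
  have hsum : ∑ ω, ((B ω : ℝ) * A' ω) / (A ω * B' ω) ≤ ∑ _ω : Ω, 1 := by
    -- `B ω` and `A' ω` count points `ω1` and `ω2`; the sum over `ω` is then taken first
    have e1 : ∀ ω, ((B ω : ℝ) * A' ω) / (A ω * B' ω) =
        ∑ ω1, ∑ ω2, if (f ω1, g ω1) = (f ω, g ω) ∧ g' ω2 = g' ω then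
          1 / ((A ω1 : ℝ) * B' ω) else 0 := by
      intro ω
      have : ∀ ω1 ω2, (if (f ω1, g ω1) = (f ω, g ω) ∧ g' ω2 = g' ω then
          1 / ((A ω1 : ℝ) * B' ω) else 0) =
          (if (f ω1, g ω1) = (f ω, g ω) then (1 : ℝ) else 0) * (if g' ω2 = g' ω then 1 else 0) *
            (1 / (A ω * B' ω)) := by
        intro ω1 ω2
        by_cases h1 : (f ω1, g ω1) = (f ω, g ω)
        · have : A ω1 = A ω := fiberCard_eq (Prod.ext_iff.mp h1).2
          simp [h1, this]
        · simp [h1]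
      simp_rw [this, ← Finset.sum_mul, ← Finset.mul_sum, ← Finset.sum_mul]
      rw [← fiberCard_eq_sum (fun ω => (f ω, g ω)), ← fiberCard_eq_sum g']
      ring
    simp_rw [e1]
    rw [Finset.sum_comm]
    refine Finset.sum_le_sum fun ω1 _ => ?_
    rw [Finset.sum_comm]
    have e2 : ∀ ω2, (∑ ω, if (f ω1, g ω1) = (f ω, g ω) ∧ g' ω2 = g' ω then
        1 / ((A ω1 : ℝ) * B' ω) else 0) ≤ (if g ω2 = g ω1 then 1 else 0) * (1 / A ω1) := by
      intro ω2
      by_cases hex : ∃ ω, (f ω1, g ω1) = (f ω, g ω) ∧ g' ω2 = g' ω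
      · obtain ⟨ω0, h1, h2⟩ := hex
        have hg : g ω2 = g ω1 := (h _ _ h2).trans (Prod.ext_iff.mp h1).2.symm
        -- the points `ω` that contribute form one fibre of `(f, g')`
        have : ∀ ω, (if (f ω1, g ω1) = (f ω, g ω) ∧ g' ω2 = g' ω then
            1 / ((A ω1 : ℝ) * B' ω) else 0) =
            (if (f ω, g' ω) = (f ω0, g' ω0) then 1 else 0) * (1 / ((A ω1 : ℝ) * B' ω0)) := by
          intro ω
          have hiff : ((f ω1, g ω1) = (f ω, g ω) ∧ g' ω2 = g' ω) ↔
              (f ω, g' ω) = (f ω0, g' ω0) := by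
            simp only [Prod.mk.injEq] at h1 ⊢
            constructor
            · rintro ⟨⟨h3, _⟩, h4⟩
              exact ⟨h3.symm.trans h1.1, h4.symm.trans h2⟩
            · rintro ⟨h3, h4⟩
              exact ⟨⟨h1.1.trans h3.symm, h1.2.trans (h _ _ h4).symm⟩, h2.trans h4.symm⟩
          by_cases hc : (f ω, g' ω) = (f ω0, g' ω0)
          · have : B' ω = B' ω0 := fiberCard_eq (f := fun ω => (f ω, g' ω)) hc
            rw [if_pos (hiff.mpr hc), if_pos hc, this, one_mul]
          · rw [if_neg (fun hh => hc (hiff.mp hh)), if_neg hc, zero_mul]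
        simp_rw [this]
        rw [← Finset.sum_mul, ← fiberCard_eq_sum (fun ω => (f ω, g' ω)), if_pos hg]
        have := hA ω1; have := hB' ω0
        change (B' ω0 : ℝ) * _ ≤ _
        apply le_of_eq
        field_simp
      · push Not at hex
        rw [Finset.sum_eq_zero]
        · have := hA ω1
          positivity
        · intro ω _
          rw [if_neg]
          rintro ⟨h1, h2⟩
          exact hex ω h1 h2
    refine (Finset.sum_le_sum fun ω2 _ => e2 ω2).trans ?_
    rw [← Finset.sum_mul, ← fiberCard_eq_sum g]
    have := hA ω1
    change (A ω1 : ℝ) * _ ≤ _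
    apply le_of_eq
    field_simp
  have := Finset.sum_le_sum fun ω (_ : ω ∈ Finset.univ) => hlog ω
  rw [Finset.sum_add_distrib, Finset.sum_sub_distrib] at this
  linarith

theorem finCondEntropy_comp_equiv {Ω' : Type*} [Fintype Ω'] (e : Ω' ≃ Ω) (f : Ω → α) (g : Ω → β) :
    finCondEntropy (fun ω => f (e ω)) (fun ω => g (e ω)) = finCondEntropy f g := by
  unfold finCondEntropy
  rw [Fintype.card_congr e, ← e.sum_comp]
  congr 1
  refine Finset.sum_congr rfl fun ω _ => ?_
  rw [fiberCard_comp_equiv e g, ← fiberCard_comp_equiv e fun ω => (f ω, g ω)]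

/-- A second coordinate that is known and independent of everything else does not matter. -/
theorem finCondEntropy_prod {Ω' : Type*} [Fintype Ω'] [Nonempty Ω'] (f : Ω → α) (g : Ω → β) :
    finCondEntropy (fun ω : Ω × Ω' => f ω.1) (fun ω => (g ω.1, ω.2)) = finCondEntropy f g := by
  unfold finCondEntropy
  have : ∀ ω : Ω × Ω', fiberCard (fun ω : Ω × Ω' => (f ω.1, (g ω.1, ω.2))) ω =
      fiberCard (fun ω => (f ω, g ω)) ω.1 := by
    intro ω
    rw [← fiberCard_prod fun ω => (f ω, g ω)]
    exact fiberCard_congr (fun _ _ => by simp only [Prod.mk.injEq]; tauto) ω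
  simp_rw [fiberCard_prod g, this]
  rw [Fintype.sum_prod_type, Fintype.card_prod]
  simp only [Finset.sum_const, Finset.card_univ, nsmul_eq_mul, ← Finset.mul_sum]
  push_cast
  rw [mul_comm, mul_div_mul_right]
  exact_mod_cast Fintype.card_ne_zero

/-- A lower bound for conditional entropy that is linear in the sizes of the fibres, and hence can
be averaged over random codes. The reference `ν` is any subprobability on the values of `g`. -/
theorem neg_log_le_finCondEntropy [Nonempty Ω] (f : Ω → α) (g : Ω → β) (s : Finset β)
    (hs : ∀ ω, g ω ∈ s) (ν : β → ℝ) (hν : ∀ ω, 0 < ν (g ω)) (hν0 : ∀ z ∈ s, 0 ≤ ν z)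
    (hν1 : ∑ z ∈ s, ν z ≤ 1) :
    -Real.log ((∑ ω, fiberCard (fun ω => (f ω, g ω)) ω / ν (g ω)) / (Fintype.card Ω : ℝ) ^ 2) ≤
      finCondEntropy f g := by
  set n : ℝ := (Fintype.card Ω : ℝ)
  have hn : 0 < n := by
    simp only [n]; exact_mod_cast Fintype.card_pos
  set A := fiberCard g
  set B := fiberCard (fun ω => (f ω, g ω))
  have hA : ∀ ω, (0 : ℝ) < A ω := fun ω => by exact_mod_cast fiberCard_pos _ ω
  have hB : ∀ ω, (0 : ℝ) < B ω := fun ω => by exact_mod_cast fiberCard_pos _ ω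
  set Ψ := (∑ ω, B ω / ν (g ω)) / n ^ 2
  have hΨ : 0 < Ψ := by
    apply div_pos _ (by positivity)
    exact Finset.sum_pos (fun ω _ => div_pos (hB ω) (hν ω)) Finset.univ_nonempty
  -- Gibbs' inequality against `ν`, and Jensen's inequality in the form `log x ≤ x - 1`
  have hlog : ∀ ω, -Real.log Ψ - (n * ν (g ω) / A ω - 1) - (B ω / (n * ν (g ω)) / Ψ - 1) ≤
      Real.log (A ω / B ω) := by
    intro ω
    have := hA ω; have := hB ω; have := hν ω
    have h1 := Real.log_le_sub_one_of_pos (show 0 < n * ν (g ω) / A ω by positivity)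
    have h2 := Real.log_le_sub_one_of_pos (show 0 < B ω / (n * ν (g ω)) / Ψ by positivity)
    have h3 : Real.log (n * ν (g ω) / A ω) + Real.log (B ω / (n * ν (g ω)) / Ψ) + Real.log Ψ +
        Real.log (A ω / B ω) = 0 := by
      have e1 := Real.log_div (x := n * ν (g ω)) (y := A ω) (by positivity) (by positivity)
      have e2 := Real.log_div (x := B ω / (n * ν (g ω))) (y := Ψ) (by positivity) (by positivity)
      have e3 := Real.log_div (x := B ω) (y := n * ν (g ω)) (by positivity) (by positivity)
      have e4 := Real.log_div (x := A ω) (y := B ω) (by positivity) (by positivity)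
      linarith
    linarith
  have h1 : ∑ ω, n * ν (g ω) / A ω ≤ n := by
    have : ∑ ω, ν (g ω) / A ω ≤ 1 := by
      refine le_trans ?_ hν1
      have e1 : ∀ z, ∑ ω with g ω = z, ν (g ω) / A ω ≤ if z ∈ s then ν z else 0 := by
        intro z
        by_cases hz : ∃ ω0, g ω0 = z
        · obtain ⟨ω0, rfl⟩ := hz
          rw [if_pos (hs ω0)]
          have : ∀ ω ∈ Finset.univ.filter (fun ω => g ω = g ω0),
              ν (g ω) / A ω = ν (g ω0) / A ω0 := by
            intro ω hω
            have h := (Finset.mem_filter.mp hω).2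
            have : A ω = A ω0 := fiberCard_eq h
            rw [h, this]
          rw [Finset.sum_congr rfl this, Finset.sum_const, nsmul_eq_mul]
          change (A ω0 : ℝ) * _ ≤ _
          have := hA ω0
          apply le_of_eq
          field_simp
        · push Not at hz
          rw [Finset.sum_eq_zero]
          · split_ifs with h
            · exact hν0 z h
            · exact le_rfl
          · intro ω hω
            exact absurd (Finset.mem_filter.mp hω).2 (hz ω)
      calc ∑ ω, ν (g ω) / A ω = ∑ z ∈ s, ∑ ω with g ω = z, ν (g ω) / A ω :=
            (Finset.sum_fiberwise_of_maps_to (fun ω _ => hs ω) _).symm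
        _ ≤ ∑ z ∈ s, ν z := Finset.sum_le_sum fun z hz => by simpa [hz] using e1 z
    calc ∑ ω, n * ν (g ω) / A ω = n * ∑ ω, ν (g ω) / A ω := by
          rw [Finset.mul_sum]; exact Finset.sum_congr rfl fun _ _ => by ring
      _ ≤ n := by nlinarith
  have h2 : ∑ ω, B ω / (n * ν (g ω)) / Ψ = n := by
    have : ∑ ω, B ω / (n * ν (g ω)) / Ψ = (∑ ω, B ω / ν (g ω)) / n / Ψ := by
      rw [Finset.sum_div, Finset.sum_div]
      refine Finset.sum_congr rfl fun ω _ => ?_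
      have := hν ω
      field_simp
    rw [this]
    have h4 : ∑ ω, B ω / ν (g ω) = Ψ * n ^ 2 := by
      simp only [Ψ]; field_simp
    rw [h4]
    field_simp
  unfold finCondEntropy
  rw [le_div_iff₀ hn]
  have h5 := Finset.sum_le_sum fun ω (_ : ω ∈ Finset.univ) => hlog ω
  simp only [Finset.sum_sub_distrib, Finset.sum_const, Finset.card_univ, nsmul_eq_mul] at h5
  have h6 : (Fintype.card Ω : ℝ) = n := rfl
  rw [h6, h2] at h5
  linarith

end FiniteEntropy

/-! ### Random coding for reliability and secrecy -/

section RandomCode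

open scoped Classical

/-- One word of a uniformly random code is uniformly distributed. -/
theorem card_mul_sum_apply {I X : Type*} [Fintype I] [DecidableEq I] [Fintype X] (i : I)
    (f : X → ℝ) :
    (Fintype.card X : ℝ) * ∑ c : I → X, f (c i) = Fintype.card (I → X) * ∑ x, f x := by
  have h1 : ∑ c : I → X, f (c i) = ∑ p : X × ({j // j ≠ i} → X), f p.1 :=
    Fintype.sum_equiv (Equiv.funSplitAt i X) _ _ fun c => by simp [Equiv.funSplitAt]
  rw [h1, Fintype.sum_prod_type, Fintype.card_congr (Equiv.funSplitAt i X), Fintype.card_prod]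
  simp only [Finset.sum_const, Finset.card_univ, nsmul_eq_mul, ← Finset.mul_sum]
  push_cast
  ring

/-- Two words of a uniformly random code are independent and uniformly distributed. -/
theorem card_sq_mul_sum_apply {I X : Type*} [Fintype I] [DecidableEq I] [Fintype X] {i j : I}
    (hij : i ≠ j) (φ : X → X → ℝ) :
    (Fintype.card X : ℝ) ^ 2 * ∑ c : I → X, φ (c i) (c j) =
      Fintype.card (I → X) * ∑ x, ∑ y, φ x y := by
  have h1 : ∑ c : I → X, φ (c i) (c j) =
      ∑ p : X × ({l // l ≠ i} → X), φ p.1 (p.2 ⟨j, hij.symm⟩) :=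
    Fintype.sum_equiv (Equiv.funSplitAt i X) _ _ fun c => by simp [Equiv.funSplitAt]
  have h2 := fun x => card_mul_sum_apply (⟨j, hij.symm⟩ : {l // l ≠ i}) (φ x)
  rw [h1, Fintype.sum_prod_type, Fintype.card_congr (Equiv.funSplitAt i X), Fintype.card_prod,
    pow_two, mul_assoc, Finset.mul_sum]
  simp only [h2]
  rw [← Finset.mul_sum]
  push_cast
  ring

variable {X R Z W B : Type*} [Fintype X] [Fintype R] [Fintype W] [Fintype B]

theorem sum_one_div_fiberCard_le {Ω β : Type*} [Fintype Ω] (f : Ω → β) (s : Finset β)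
    (hs : ∀ ω, f ω ∈ s) : ∑ ω, 1 / (fiberCard f ω : ℝ) ≤ s.card := by
  rw [← Finset.sum_fiberwise_of_maps_to (fun ω _ => hs ω), Finset.card_eq_sum_ones, Nat.cast_sum]
  refine Finset.sum_le_sum fun z _ => ?_
  by_cases hz : ∃ ω0, f ω0 = z
  · obtain ⟨ω0, rfl⟩ := hz
    have : ∀ ω ∈ Finset.univ.filter (fun ω => f ω = f ω0),
        1 / (fiberCard f ω : ℝ) = 1 / fiberCard f ω0 := fun ω hω => by
      rw [fiberCard_eq (Finset.mem_filter.mp hω).2]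
    rw [Finset.sum_congr rfl this, Finset.sum_const, nsmul_eq_mul]
    change (fiberCard f ω0 : ℝ) * _ ≤ _
    have : (0 : ℝ) < fiberCard f ω0 := by exact_mod_cast fiberCard_pos f ω0
    apply le_of_eq
    field_simp
    simp
  · push Not at hz
    rw [Finset.sum_eq_zero]
    · simp
    · intro ω hω
      exact absurd (Finset.mem_filter.mp hω).2 (hz ω)

/-- The number of pairs of jamming words `r`, `r'` for which `x` and `x'` look alike to an
observer of `g x r`, each weighted by the inverse of the probability of the common value when both
arguments of `g` are uniform. -/
noncomputable def confusion (g : X → R → Z) (x x' : X) : ℝ :=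
  ∑ r, ∑ r', if g x' r' = g x r then
    (Fintype.card X * Fintype.card R : ℝ) / fiberCard (fun p : X × R => g p.1 p.2) (x, r) else 0

theorem sum_confusion_self_le (g : X → R → Z) (hg : ∀ x, Function.Injective (g x)) (s : Finset Z)
    (hs : ∀ x r, g x r ∈ s) :
    ∑ x, confusion g x x ≤ Fintype.card X * Fintype.card R * s.card := by
  have h1 : ∀ x, confusion g x x = ∑ r, (Fintype.card X * Fintype.card R : ℝ) *
      (1 / fiberCard (fun p : X × R => g p.1 p.2) (x, r)) := by
    intro x
    unfold confusion
    refine Finset.sum_congr rfl fun r _ => ?_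
    simp only [(hg x).eq_iff, Finset.sum_ite_eq', Finset.mem_univ, if_true]
    ring
  simp_rw [h1, ← Finset.mul_sum]
  gcongr
  have := sum_one_div_fiberCard_le (fun p : X × R => g p.1 p.2) s fun p => hs p.1 p.2
  rwa [Fintype.sum_prod_type] at this

theorem sum_confusion (g : X → R → Z) :
    ∑ x, ∑ x', confusion g x x' = ((Fintype.card X : ℝ) * Fintype.card R) ^ 2 := by
  have h1 : ∀ x, ∑ x', confusion g x x' = ∑ _r : R, (Fintype.card X * Fintype.card R : ℝ) := by
    intro x
    unfold confusion
    rw [Finset.sum_comm]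
    refine Finset.sum_congr rfl fun r _ => ?_
    have h2 := fiberCard_eq_sum (fun p : X × R => g p.1 p.2) (x, r)
    rw [Fintype.sum_prod_type] at h2
    have h3 : (0 : ℝ) < fiberCard (fun p : X × R => g p.1 p.2) (x, r) := by
      exact_mod_cast fiberCard_pos _ _
    have h4 : ∀ x' r', (if g x' r' = g x r then (Fintype.card X * Fintype.card R : ℝ) /
        fiberCard (fun p : X × R => g p.1 p.2) (x, r) else 0) =
        (if g x' r' = g x r then 1 else 0) * ((Fintype.card X * Fintype.card R : ℝ) /
        fiberCard (fun p : X × R => g p.1 p.2) (x, r)) := by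
      intro x' r'
      split_ifs <;> simp
    simp_rw [h4, ← Finset.sum_mul]
    rw [← h2]
    field_simp
  simp_rw [h1]
  simp only [Finset.sum_const, Finset.card_univ, nsmul_eq_mul]
  ring

theorem confusion_nonneg (g : X → R → Z) (x x' : X) : 0 ≤ confusion g x x' :=
  Finset.sum_nonneg fun _ _ => Finset.sum_nonneg fun _ _ => by split_ifs <;> positivity

theorem sum_confusion_pos [Nonempty R] [Nonempty W] [Nonempty B] (g : X → R → Z) (c : W × B → X) :
    0 < ∑ w, ∑ b, ∑ b', confusion g (c (w, b)) (c (w, b')) := by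
  have hself : ∀ x, 0 < confusion g x x := by
    intro x
    have hX : (0 : ℝ) < Fintype.card X := by exact_mod_cast Fintype.card_pos_iff.mpr ⟨x⟩
    have hR : (0 : ℝ) < Fintype.card R := by exact_mod_cast Fintype.card_pos
    refine Finset.sum_pos (fun r _ => Finset.sum_pos' (fun r' _ => ?_) ⟨r, Finset.mem_univ _, ?_⟩)
      Finset.univ_nonempty
    · split_ifs <;> positivity
    · have : (0 : ℝ) < fiberCard (fun p : X × R => g p.1 p.2) (x, r) := by
        exact_mod_cast fiberCard_pos _ _
      rw [if_pos rfl]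
      positivity
  exact Finset.sum_pos (fun w _ => Finset.sum_pos (fun b _ => Finset.sum_pos'
    (fun b' _ => confusion_nonneg _ _ _) ⟨b, Finset.mem_univ _, hself _⟩)
    Finset.univ_nonempty) Finset.univ_nonempty

/-- The secrecy of the message of a given code, in terms of the confusion of words with the same
message. The reference law is that of `g` under uniform arguments. -/
theorem log_sub_log_le_finCondEntropy [Nonempty X] [Nonempty R] [Nonempty W] [Nonempty B]
    (g : X → R → Z) (s : Finset Z) (hs : ∀ x r, g x r ∈ s) (c : W × B → X) :
    Real.log (Fintype.card W) -
      Real.log ((∑ w, ∑ b, ∑ b', confusion g (c (w, b)) (c (w, b'))) /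
        (Fintype.card W * (Fintype.card B * Fintype.card R : ℝ) ^ 2)) ≤
      finCondEntropy (fun ω : W × B × R => ω.1) (fun ω => g (c (ω.1, ω.2.1)) ω.2.2) := by
  let G : X × R → Z := fun p => g p.1 p.2
  let ν : Z → ℝ := fun z =>
    ((Finset.univ.filter fun p : X × R => G p = z).card : ℝ) / (Fintype.card X * Fintype.card R)
  have hX : (0 : ℝ) < Fintype.card X := by exact_mod_cast Fintype.card_pos
  have hR : (0 : ℝ) < Fintype.card R := by exact_mod_cast Fintype.card_pos
  have hW : (0 : ℝ) < Fintype.card W := by exact_mod_cast Fintype.card_pos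
  have hB : (0 : ℝ) < Fintype.card B := by exact_mod_cast Fintype.card_pos
  have hνG : ∀ x r, ν (g x r) = fiberCard G (x, r) / (Fintype.card X * Fintype.card R) :=
    fun x r => rfl
  have hνpos : ∀ x r, 0 < ν (g x r) := fun x r => by
    rw [hνG]
    have : (0 : ℝ) < fiberCard G (x, r) := by exact_mod_cast fiberCard_pos _ _
    positivity
  have hν1 : ∑ z ∈ s, ν z ≤ 1 := by
    simp only [ν]
    rw [← Finset.sum_div, div_le_one (by positivity), ← Nat.cast_sum,
      ← Finset.card_eq_sum_card_fiberwise (f := G) (s := Finset.univ) (t := s)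
        (fun p _ => hs p.1 p.2)]
    simp
  have key := neg_log_le_finCondEntropy (fun ω : W × B × R => ω.1)
    (fun ω => g (c (ω.1, ω.2.1)) ω.2.2) s (fun ω => hs _ _) ν (fun ω => hνpos _ _)
    (fun z _ => by positivity) hν1
  have hsum : ∑ ω : W × B × R, (fiberCard
      (fun ω : W × B × R => (ω.1, g (c (ω.1, ω.2.1)) ω.2.2)) ω : ℝ) /
        ν (g (c (ω.1, ω.2.1)) ω.2.2) =
      ∑ w, ∑ b, ∑ b', confusion g (c (w, b)) (c (w, b')) := by
    rw [Fintype.sum_prod_type]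
    refine Finset.sum_congr rfl fun w _ => ?_
    rw [Fintype.sum_prod_type]
    refine Finset.sum_congr rfl fun b _ => ?_
    unfold confusion
    rw [Finset.sum_comm]
    refine Finset.sum_congr rfl fun r _ => ?_
    rw [fiberCard_eq_sum, Fintype.sum_prod_type, Finset.sum_eq_single w, Fintype.sum_prod_type,
      Finset.sum_div]
    · refine Finset.sum_congr rfl fun b' _ => ?_
      rw [Finset.sum_div]
      refine Finset.sum_congr rfl fun r' _ => ?_
      simp only [Prod.mk.injEq, true_and, hνG]
      split_ifs
      · rw [one_div_div]
      · simp
    · intro w' _ hw'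
      simp [hw']
    · simp
  rw [hsum] at key
  refine le_trans (le_of_eq ?_) key
  set S := ∑ w, ∑ b, ∑ b', confusion g (c (w, b)) (c (w, b'))
  have hS : 0 < S := sum_confusion_pos g c
  simp only [Fintype.card_prod, Nat.cast_mul]
  rw [Real.log_div hS.ne' (by positivity), Real.log_div hS.ne' (by positivity),
    Real.log_pow, Real.log_mul hW.ne' (by positivity), Real.log_mul hW.ne' (by positivity),
    Real.log_pow]
  push_cast
  ring

/-- Random coding: a code `c` of `W × B` words such that few words have another word close by and
the message in `W` is almost hidden from an observer of `g (c (w, b)) r`, with `r` uniform. -/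
theorem exists_secret_code [Nonempty X] [Nonempty R] [Nonempty W] [Nonempty B]
    (g : X → R → Z) (hg : ∀ x, Function.Injective (g x)) (s : Finset Z) (hs : ∀ x r, g x r ∈ s)
    (close : X → X → Prop) (v : ℕ) (hv : 0 < v)
    (hclose : ∀ x, (Finset.univ.filter fun x' => close x x').card ≤ v) :
    ∃ c : W × B → X,
      ((Finset.univ.filter fun i => ∃ i', i' ≠ i ∧ close (c i) (c i')).card : ℝ) ≤
        2 * ((Fintype.card W * Fintype.card B : ℝ) ^ 2 * v / Fintype.card X) ∧
      Real.log (Fintype.card W) -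
          Real.log (2 * (1 + s.card / (Fintype.card B * Fintype.card R : ℝ))) ≤
        finCondEntropy (fun ω : W × B × R => ω.1) (fun ω => g (c (ω.1, ω.2.1)) ω.2.2) := by
  have hX : (0 : ℝ) < Fintype.card X := by exact_mod_cast Fintype.card_pos
  have hR : (0 : ℝ) < Fintype.card R := by exact_mod_cast Fintype.card_pos
  have hW : (0 : ℝ) < Fintype.card W := by exact_mod_cast Fintype.card_pos
  have hB : (0 : ℝ) < Fintype.card B := by exact_mod_cast Fintype.card_pos
  have hv' : (0 : ℝ) < v := by exact_mod_cast hv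
  set C : ℝ := (Fintype.card (W × B → X) : ℝ)
  have hC : 0 < C := by simp only [C]; exact_mod_cast Fintype.card_pos
  set a₁ : ℝ := (Fintype.card W * Fintype.card B : ℝ) ^ 2 * v / Fintype.card X
  set a₂ : ℝ := 1 + s.card / (Fintype.card B * Fintype.card R : ℝ)
  have ha₁ : 0 < a₁ := by positivity
  have ha₂ : 0 < a₂ := by positivity
  let bad : (W × B → X) → ℝ := fun c =>
    (Finset.univ.filter fun i => ∃ i', i' ≠ i ∧ close (c i) (c i')).card
  let Ψ : (W × B → X) → ℝ := fun c => (∑ w, ∑ b, ∑ b', confusion g (c (w, b)) (c (w, b'))) /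
        (Fintype.card W * (Fintype.card B * Fintype.card R : ℝ) ^ 2)
  have hbad0 : ∀ c, 0 ≤ bad c := fun c => by positivity
  have hΨ0 : ∀ c, 0 ≤ Ψ c := fun c => by
    have : 0 ≤ ∑ w, ∑ b, ∑ b', confusion g (c (w, b)) (c (w, b')) :=
      Finset.sum_nonneg fun _ _ => Finset.sum_nonneg fun _ _ => Finset.sum_nonneg fun _ _ =>
        confusion_nonneg _ _ _
    positivity
  -- reliability: pairs of distinct words are independent
  have hbadE : ∑ c, bad c ≤ C * a₁ := by
    have h1 : ∀ c, bad c ≤ ∑ i, ∑ i', if i' ≠ i then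
        (if close (c i) (c i') then (1 : ℝ) else 0) else 0 := by
      intro c
      simp only [bad, Finset.card_filter]
      push_cast
      refine Finset.sum_le_sum fun i _ => ?_
      split_ifs with hex
      · obtain ⟨i', h1, h2⟩ := hex
        calc (1 : ℝ) = if i' ≠ i then (if close (c i) (c i') then (1 : ℝ) else 0) else 0 := by
              simp [h1, h2]
          _ ≤ _ := Finset.single_le_sum (f := fun i' => if i' ≠ i then
                (if close (c i) (c i') then (1 : ℝ) else 0) else 0)
              (fun _ _ => by positivity) (Finset.mem_univ i')
      · exact Finset.sum_nonneg fun _ _ => by positivity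
    refine (Finset.sum_le_sum fun c _ => h1 c).trans ?_
    rw [Finset.sum_comm]
    have h2 : ∀ i i', (∑ c : W × B → X, if i' ≠ i then
        (if close (c i) (c i') then (1 : ℝ) else 0) else 0) ≤ C * (v / Fintype.card X) := by
      intro i i'
      by_cases hi : i' = i
      · simp [hi]
        positivity
      · simp only [if_pos (show i' ≠ i from hi)]
        have h3 := card_sq_mul_sum_apply (I := W × B) (Ne.symm hi)
          (fun x y : X => if close x y then (1 : ℝ) else 0)
        have h4 : ∑ x : X, ∑ y, (if close x y then (1 : ℝ) else 0) ≤ Fintype.card X * v := by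
          calc _ ≤ ∑ _x : X, (v : ℝ) := Finset.sum_le_sum fun x _ => by
                rw [Finset.sum_boole]; exact_mod_cast hclose x
            _ = _ := by simp
        have h5 : (Fintype.card X : ℝ) ^ 2 * ∑ c : W × B → X,
            (if close (c i) (c i') then (1 : ℝ) else 0) ≤
            (Fintype.card X : ℝ) ^ 2 * (C * (v / Fintype.card X)) := by
          rw [h3]
          calc _ ≤ C * (Fintype.card X * v) := by gcongr
            _ = _ := by field_simp
        exact le_of_mul_le_mul_left h5 (by positivity)
    calc _ = ∑ i, ∑ i', ∑ c : W × B → X, (if i' ≠ i then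
        (if close (c i) (c i') then (1 : ℝ) else 0) else 0) :=
          Finset.sum_congr rfl fun i _ => Finset.sum_comm
      _ ≤ ∑ _i : W × B, ∑ _i' : W × B, C * (v / Fintype.card X) :=
          Finset.sum_le_sum fun i _ => Finset.sum_le_sum fun i' _ => h2 i i'
      _ = C * a₁ := by
          simp only [Finset.sum_const, Finset.card_univ, nsmul_eq_mul, Fintype.card_prod, a₁]
          push_cast
          ring
  -- secrecy: distinct words of one message are independent, and `B` words outweigh the diagonal
  have hΨE : ∑ c, Ψ c ≤ C * a₂ := by
    have h2 : ∀ w b b', ∑ c : W × B → X, confusion g (c (w, b)) (c (w, b')) ≤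
        C * ((if b' = b then (Fintype.card R : ℝ) * s.card else 0) + (Fintype.card R : ℝ) ^ 2) := by
      intro w b b'
      by_cases hb : b' = b
      · subst hb
        rw [if_pos rfl]
        have h3 := card_mul_sum_apply (I := W × B) (w, b') fun x => confusion g x x
        have h4 := sum_confusion_self_le g hg s hs
        have h5 : (Fintype.card X : ℝ) * ∑ c : W × B → X, confusion g (c (w, b')) (c (w, b')) ≤
            Fintype.card X * (C * ((Fintype.card R : ℝ) * s.card)) := by
          rw [h3]
          calc _ ≤ C * (Fintype.card X * Fintype.card R * s.card) := by gcongr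
            _ = _ := by ring
        have h6 := le_of_mul_le_mul_left h5 hX
        have : 0 ≤ C * (Fintype.card R : ℝ) ^ 2 := by positivity
        linarith
      · rw [if_neg hb, zero_add]
        have h3 := card_sq_mul_sum_apply (I := W × B) (i := (w, b)) (j := (w, b'))
          (by simpa using fun h => hb h.symm) (confusion g)
        rw [sum_confusion] at h3
        have h5 : (Fintype.card X : ℝ) ^ 2 * ∑ c : W × B → X, confusion g (c (w, b)) (c (w, b')) =
            (Fintype.card X : ℝ) ^ 2 * (C * (Fintype.card R : ℝ) ^ 2) := by
          rw [h3]; ring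
        exact (mul_left_cancel₀ (by positivity) h5).le
    have h7 : ∑ c : W × B → X, ∑ w, ∑ b, ∑ b', confusion g (c (w, b)) (c (w, b')) ≤
        C * (Fintype.card W * (Fintype.card B * Fintype.card R * s.card +
          (Fintype.card B * Fintype.card R) ^ 2)) := by
      calc _ = ∑ w, ∑ b, ∑ b', ∑ c : W × B → X, confusion g (c (w, b)) (c (w, b')) := by
            rw [Finset.sum_comm]
            refine Finset.sum_congr rfl fun w _ => ?_
            rw [Finset.sum_comm]
            exact Finset.sum_congr rfl fun b _ => Finset.sum_comm
        _ ≤ ∑ _w : W, ∑ b : B, ∑ b' : B, C * ((if b' = b then (Fintype.card R : ℝ) * s.card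
              else 0) + (Fintype.card R : ℝ) ^ 2) :=
            Finset.sum_le_sum fun w _ => Finset.sum_le_sum fun b _ =>
              Finset.sum_le_sum fun b' _ => h2 w b b'
        _ = _ := by
            simp only [mul_add, Finset.sum_add_distrib, mul_ite, mul_zero, Finset.sum_ite_eq',
              Finset.mem_univ, if_true, Finset.sum_const, Finset.card_univ, nsmul_eq_mul]
            ring
    simp only [Ψ]
    rw [← Finset.sum_div, div_le_iff₀ (by positivity)]
    refine h7.trans (le_of_eq ?_)
    simp only [a₂]
    field_simp
    ring
  -- both criteria are within a factor of two of their means for a single code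
  obtain ⟨c, hc⟩ : ∃ c, bad c / a₁ + Ψ c / a₂ ≤ 2 := by
    by_contra! hcon
    have h1 : ∑ _c : W × B → X, (2 : ℝ) < ∑ c, (bad c / a₁ + Ψ c / a₂) :=
      Finset.sum_lt_sum_of_nonempty Finset.univ_nonempty fun c _ => hcon c
    rw [Finset.sum_add_distrib, ← Finset.sum_div, ← Finset.sum_div] at h1
    have h2 : (∑ c, bad c) / a₁ ≤ C := by rwa [div_le_iff₀ ha₁]
    have h3 : (∑ c, Ψ c) / a₂ ≤ C := by rwa [div_le_iff₀ ha₂]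
    simp only [Finset.sum_const, Finset.card_univ, nsmul_eq_mul] at h1
    change C * 2 < _ at h1
    linarith
  have h1 : bad c ≤ 2 * a₁ := by
    rw [← div_le_iff₀ ha₁]
    have : 0 ≤ Ψ c / a₂ := div_nonneg (hΨ0 c) ha₂.le
    linarith
  have h2 : Ψ c ≤ 2 * a₂ := by
    rw [← div_le_iff₀ ha₂]
    have : 0 ≤ bad c / a₁ := div_nonneg (hbad0 c) ha₁.le
    linarith
  refine ⟨c, h1, le_trans ?_ (log_sub_log_le_finCondEntropy g s hs c)⟩
  have h3 : 0 < Ψ c := by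
    have := sum_confusion_pos g c
    positivity
  have := Real.log_le_log h3 h2
  simp only [Ψ] at this
  linarith

end RandomCode

/-! ### Entropy of the messages given a noisy function of finite data -/

section EntropyOfMixture

open scoped Classical

variable {Ω₀ α υ : Type*} [Fintype Ω₀]

/-- The conditional probability of `f = a` given the value of `U` at `ω`, on a uniform space. -/
noncomputable def fiberProb (f : Ω₀ → α) (U : Ω₀ → υ) (a : α) (ω : Ω₀) : ℝ :=
  ((Finset.univ.filter fun ω' => f ω' = a ∧ U ω' = U ω).card : ℝ) / fiberCard U ω

theorem fiberProb_nonneg (f : Ω₀ → α) (U : Ω₀ → υ) (a : α) (ω : Ω₀) : 0 ≤ fiberProb f U a ω := by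
  unfold fiberProb; positivity

theorem sum_fiberProb [Fintype α] (f : Ω₀ → α) (U : Ω₀ → υ) (ω : Ω₀) :
    ∑ a, fiberProb f U a ω = 1 := by
  unfold fiberProb
  have h : (0 : ℝ) < fiberCard U ω := by exact_mod_cast fiberCard_pos _ _
  rw [← Finset.sum_div, div_eq_one_iff_eq h.ne', ← Nat.cast_sum]
  congr 1
  unfold fiberCard
  rw [Finset.card_eq_sum_card_fiberwise (f := f) (t := Finset.univ) (fun _ _ => by simp)]
  refine Finset.sum_congr rfl fun a _ => ?_
  rw [Finset.filter_filter]
  congr 1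
  ext ω'
  simp [and_comm]

theorem fiberProb_congr (f : Ω₀ → α) {U : Ω₀ → υ} (a : α) {ω ω' : Ω₀} (h : U ω = U ω') :
    fiberProb f U a ω = fiberProb f U a ω' := by
  unfold fiberProb
  rw [h, fiberCard_eq h]

/-- The tower property, against functions `ψ` of `U`. -/
theorem sum_fiberProb_mul (f : Ω₀ → α) (U : Ω₀ → υ) (a : α) (ψ : Ω₀ → ℝ)
    (hψ : ∀ ω ω', U ω = U ω' → ψ ω = ψ ω') :
    ∑ ω, fiberProb f U a ω * ψ ω = ∑ ω, if f ω = a then ψ ω else 0 := by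
  have h1 : ∀ ω, fiberProb f U a ω * ψ ω =
      ∑ ω', if f ω' = a then (if U ω = U ω' then ψ ω' / fiberCard U ω' else 0) else 0 := by
    intro ω
    unfold fiberProb
    rw [Finset.card_filter]
    push_cast
    rw [Finset.sum_div, Finset.sum_mul]
    refine Finset.sum_congr rfl fun ω' _ => ?_
    by_cases h1 : f ω' = a <;> by_cases h2 : U ω' = U ω
    · simp only [h1, h2, and_self, if_true]
      rw [hψ ω' ω h2, fiberCard_eq h2]
      ring
    · simp [h1, h2, Ne.symm h2]
    · simp [h1]
    · simp [h1]
  simp_rw [h1]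
  rw [Finset.sum_comm]
  refine Finset.sum_congr rfl fun ω' _ => ?_
  split_ifs
  · rw [← Finset.sum_filter, Finset.sum_const, nsmul_eq_mul]
    have h : (0 : ℝ) < fiberCard U ω' := by exact_mod_cast fiberCard_pos _ _
    change (fiberCard U ω' : ℝ) * _ = _
    field_simp
  · simp

theorem sum_sum_negMulLog_fiberProb [Fintype α] (f : Ω₀ → α) (U : Ω₀ → υ) :
    (∑ ω, ∑ a, Real.negMulLog (fiberProb f U a ω)) / Fintype.card Ω₀ = finCondEntropy f U := by
  unfold finCondEntropy
  congr 1
  rw [Finset.sum_comm]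
  have h1 : ∀ a, ∑ ω, Real.negMulLog (fiberProb f U a ω) =
      ∑ ω, if f ω = a then -Real.log (fiberProb f U a ω) else 0 := by
    intro a
    rw [← sum_fiberProb_mul f U a (fun ω => -Real.log (fiberProb f U a ω))
      (fun ω ω' h => by rw [fiberProb_congr f a h])]
    refine Finset.sum_congr rfl fun ω _ => ?_
    rw [Real.negMulLog]
    ring
  simp_rw [h1]
  rw [Finset.sum_comm]
  refine Finset.sum_congr rfl fun ω _ => ?_
  rw [Finset.sum_ite_eq Finset.univ (f ω), if_pos (Finset.mem_univ _), ← Real.log_inv]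
  congr 1
  unfold fiberProb
  rw [inv_div]
  congr 2
  unfold fiberCard
  congr 1
  ext ω'
  simp

/-- If the joint law of a finite random variable `X` and of `Y` is that of `f` and of an output of
the channel `N` with input `U`, on a uniform finite space, then `Y` tells at most as much about
`X` as `U` tells about `f`. -/
theorem finCondEntropy_le_condEntropyBits {Ω β : Type*} [MeasurableSpace Ω] [Fintype α] [Nonempty α]
    [MeasurableSpace α] [StandardBorelSpace α] [MeasurableSpace β] [Nonempty Ω₀]
    (P : Measure Ω) [IsProbabilityMeasure P] (X : Ω → α) (Y : Ω → β) (hX : Measurable X)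
    (hY : Measurable Y) (f : Ω₀ → α) (U : Ω₀ → υ) (N : υ → Measure β)
    [∀ u, IsProbabilityMeasure (N u)]
    (h : ∀ a A, MeasurableSet A → P (Y ⁻¹' A ∩ X ⁻¹' {a}) =
      ∑ ω, if f ω = a then N (U ω) A / Fintype.card Ω₀ else 0) :
    finCondEntropy f U / Real.log 2 ≤ condEntropyBits P X Y := by
  unfold condEntropyBits
  have hlog2 : 0 < Real.log 2 := Real.log_pos one_lt_two
  gcongr ?_ / _
  have : IsProbabilityMeasure (P.map Y) := Measure.isProbabilityMeasure_map hY.aemeasurable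
  set n : ℕ := Fintype.card Ω₀ with hn
  have hn0 : 0 < n := Fintype.card_pos
  set μ := P.map Y
  have hμ : ∀ A, MeasurableSet A → μ A = ∑ ω, N (U ω) A / n := by
    intro A hA
    rw [Measure.map_apply hY hA]
    have h1 : Y ⁻¹' A = ⋃ a ∈ (Finset.univ : Finset α), (Y ⁻¹' A ∩ X ⁻¹' {a}) := by
      ext ω; simp
    rw [h1, measure_biUnion_finset]
    · simp_rw [h _ A hA]
      rw [Finset.sum_comm]
      refine Finset.sum_congr rfl fun ω _ => ?_
      rw [Finset.sum_ite_eq Finset.univ (f ω), if_pos (Finset.mem_univ _)]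
    · intro a _ b _ hab
      refine Set.disjoint_left.mpr fun ω h1 h2 => hab ?_
      exact h1.2.symm.trans h2.2
    · intro a _
      exact (hY hA).inter (hX (measurableSet_singleton a))
  have hac : ∀ ω, N (U ω) ≪ μ := by
    intro ω
    refine Measure.AbsolutelyContinuous.mk fun A hA h0 => ?_
    rw [hμ A hA, Finset.sum_eq_zero_iff] at h0
    have := h0 ω (Finset.mem_univ _)
    simpa using this
  let w : Ω₀ → β → ℝ := fun ω y => ((N (U ω)).rnDeriv μ y).toReal / n
  have hw0 : ∀ ω y, 0 ≤ w ω y := fun ω y => by positivity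
  -- the posterior law of `X` given `Y` is a mixture of the laws of `f` given `U`
  have hpost : ∀ a, ∀ᵐ y ∂μ, (condDistrib X Y P y).real {a} = ∑ ω, w ω y * fiberProb f U a ω := by
    intro a
    have h1 : (fun y => condDistrib X Y P y {a}) =ᵐ[μ]
        fun y => ∑ ω, (N (U ω)).rnDeriv μ y * ENNReal.ofReal (fiberProb f U a ω / n) := by
      refine ae_eq_of_forall_setLIntegral_eq_of_sigmaFinite
        (Kernel.measurable_coe _ (measurableSet_singleton a)) (by fun_prop) fun A hA _ => ?_
      have h2 := setLIntegral_preimage_condDistrib (μ := P) (X := Y) (Y := X) hY hX.aemeasurable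
        (measurableSet_singleton a) hA
      rw [setLIntegral_map hA (Kernel.measurable_coe _ (measurableSet_singleton a)) hY, h2,
        h a A hA, lintegral_finsetSum _ (fun ω _ => by fun_prop)]
      have h3 : ∀ ω, ∫⁻ y in A, (N (U ω)).rnDeriv μ y * ENNReal.ofReal (fiberProb f U a ω / n) ∂μ =
          ENNReal.ofReal (fiberProb f U a ω * ((N (U ω)).real A / n)) := by
        intro ω
        rw [lintegral_mul_const _ (by fun_prop), Measure.setLIntegral_rnDeriv (hac ω),
          ← ofReal_measureReal, ← ENNReal.ofReal_mul (by positivity)]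
        congr 1
        ring
      simp_rw [h3]
      have hp := fun ω => fiberProb_nonneg f U a ω
      rw [← ENNReal.ofReal_sum_of_nonneg (fun ω _ => mul_nonneg (hp ω) (by positivity)),
        sum_fiberProb_mul f U a (fun ω => (N (U ω)).real A / n) (fun ω ω' h => by simp only [h]),
        ENNReal.ofReal_sum_of_nonneg (fun ω _ => by split_ifs <;> positivity)]
      refine Finset.sum_congr rfl fun ω _ => ?_
      split_ifs
      · rw [ENNReal.ofReal_div_of_pos (by exact_mod_cast hn0), ofReal_measureReal,
          ENNReal.ofReal_natCast]
      · simp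
    have h4 : ∀ᵐ y ∂μ, ∀ ω, (N (U ω)).rnDeriv μ y < ⊤ := by
      rw [ae_all_iff]
      exact fun ω => Measure.rnDeriv_lt_top _ _
    filter_upwards [h1, h4] with y hy hy4
    rw [measureReal_def, hy, ENNReal.toReal_sum fun ω _ =>
      ENNReal.mul_ne_top (hy4 ω).ne ENNReal.ofReal_ne_top]
    refine Finset.sum_congr rfl fun ω _ => ?_
    have hp := fiberProb_nonneg f U a ω
    rw [ENNReal.toReal_mul, ENNReal.toReal_ofReal (by positivity)]
    simp only [w]
    ring
  -- entropy is concave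
  have hjensen : ∀ᵐ y ∂μ, ∑ ω, w ω y * ∑ a, Real.negMulLog (fiberProb f U a ω) ≤
      ∑ a, Real.negMulLog ((condDistrib X Y P y).real {a}) := by
    filter_upwards [ae_all_iff.mpr hpost] with y hy
    have hw1 : ∑ ω, w ω y = 1 := by
      have h1 : ∑ a, (condDistrib X Y P y).real {a} = 1 := by
        rw [sum_measureReal_singleton]
        simp
      simp_rw [hy] at h1
      rw [Finset.sum_comm] at h1
      simpa [← Finset.mul_sum, sum_fiberProb] using h1
    simp_rw [hy, Finset.mul_sum]
    rw [Finset.sum_comm]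
    refine Finset.sum_le_sum fun a _ => ?_
    have := Real.concaveOn_negMulLog.le_map_sum (t := Finset.univ) (w := fun ω => w ω y)
      (p := fun ω => fiberProb f U a ω) (fun ω _ => hw0 ω y) hw1
      (fun ω _ => fiberProb_nonneg f U a ω)
    simpa [smul_eq_mul] using this
  have hwint : ∀ ω, Integrable (w ω) μ := fun ω =>
    Measure.integrable_toReal_rnDeriv.div_const _
  have hwI : ∀ ω, ∫ y, w ω y ∂μ = 1 / n := by
    intro ω
    simp only [w]
    rw [integral_div, Measure.integral_toReal_rnDeriv (hac ω)]
    simp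
  calc finCondEntropy f U
      = ∫ y, ∑ ω, w ω y * ∑ a, Real.negMulLog (fiberProb f U a ω) ∂μ := by
        rw [integral_finsetSum _ fun ω _ => (hwint ω).mul_const _]
        simp_rw [integral_mul_const, hwI]
        rw [← sum_sum_negMulLog_fiberProb, Finset.sum_div]
        exact Finset.sum_congr rfl fun ω _ => by ring
    _ ≤ _ := by
        refine integral_mono_ae (integrable_finsetSum _ fun ω _ => (hwint ω).mul_const _) ?_ hjensen
        refine integrable_finsetSum _ fun a _ => ?_
        refine Integrable.of_bound (C := 1) ?_ ?_
        · refine (Real.continuous_negMulLog.measurable.comp ?_).aestronglyMeasurable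
          exact (Kernel.measurable_coe _ (measurableSet_singleton a)).ennreal_toReal
        · refine Eventually.of_forall fun y => ?_
          have h1 : (condDistrib X Y P y).real {a} ≤ 1 := measureReal_le_one
          have h0 : 0 ≤ (condDistrib X Y P y).real {a} := measureReal_nonneg
          rw [Real.norm_of_nonneg (Real.negMulLog_nonneg h0 h1)]
          linarith [Real.negMulLog_le_one_sub_self h0]

theorem entropyBits_le {Ω : Type*} [MeasurableSpace Ω] [Fintype α] [Nonempty α] [MeasurableSpace α]
    [MeasurableSingletonClass α] (P : Measure Ω) [IsProbabilityMeasure P] (X : Ω → α)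
    (hX : Measurable X) : entropyBits P X ≤ Real.log (Fintype.card α) / Real.log 2 := by
  unfold entropyBits
  have hlog2 : 0 < Real.log 2 := Real.log_pos one_lt_two
  gcongr ?_ / _
  have : IsProbabilityMeasure (P.map X) := Measure.isProbabilityMeasure_map hX.aemeasurable
  have hα : (0 : ℝ) < Fintype.card α := by exact_mod_cast Fintype.card_pos
  have := Real.concaveOn_negMulLog.le_map_sum (t := (Finset.univ : Finset α))
      (w := fun _ => 1 / (Fintype.card α : ℝ)) (p := fun a => (P.map X).real {a})
      (fun a _ => by positivity) (by simp) (fun a _ => measureReal_nonneg)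
  simp only [smul_eq_mul, ← Finset.mul_sum, sum_measureReal_singleton, Finset.coe_univ,
    probReal_univ, mul_one] at this
  have h2 : Real.negMulLog (1 / (Fintype.card α : ℝ)) =
      1 / (Fintype.card α : ℝ) * Real.log (Fintype.card α) := by
    rw [Real.negMulLog, one_div, Real.log_inv]; ring
  rw [h2] at this
  exact le_of_mul_le_mul_left this (by positivity)

end EntropyOfMixture

/-! ### Counting bounds for Hamming balls and frequent events -/

section Counting

open scoped Classical

theorem card_hammingBall_le {T A : Type*} [Fintype T] [DecidableEq T] [Fintype A] [DecidableEq A]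
    [Nonempty A] (x : T → A) (d : ℕ) :
    (Finset.univ.filter fun x' => hammingDist x x' ≤ d).card ≤
      2 ^ Fintype.card T * Fintype.card A ^ d := by
  have hsub : (Finset.univ.filter fun x' => hammingDist x x' ≤ d) ⊆
      (Finset.univ.filter fun S : Finset T => S.card ≤ d).biUnion fun S =>
        Fintype.piFinset fun t => if t ∈ S then Finset.univ else {x t} := by
    intro x' hx'
    rw [Finset.mem_filter] at hx'
    rw [Finset.mem_biUnion]
    refine ⟨Finset.univ.filter fun t => x t ≠ x' t, ?_, ?_⟩
    · rw [Finset.mem_filter]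
      exact ⟨Finset.mem_univ _, by convert hx'.2 using 1; unfold hammingDist; congr!⟩
    · rw [Fintype.mem_piFinset]
      intro t
      by_cases h : x t = x' t <;> simp [h]
  refine (Finset.card_le_card hsub).trans (Finset.card_biUnion_le.trans ?_)
  calc _ ≤ ∑ _S ∈ Finset.univ.filter fun S : Finset T => S.card ≤ d, Fintype.card A ^ d := by
        refine Finset.sum_le_sum fun S hS => ?_
        rw [Fintype.card_piFinset]
        have : ∀ t, (if t ∈ S then Finset.univ else {x t} : Finset A).card =
            if t ∈ S then Fintype.card A else 1 := by
          intro t; split_ifs <;> simp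
        simp_rw [this]
        rw [Finset.prod_ite_mem, Finset.univ_inter, Finset.prod_const]
        exact Nat.pow_le_pow_right Fintype.card_pos (Finset.mem_filter.mp hS).2
    _ ≤ _ := by
        rw [Finset.sum_const, smul_eq_mul]
        gcongr
        refine (Finset.card_filter_le _ _).trans ?_
        simp

/-- Union bound for the event that at least `e` of `n` independent samples lie in `E`. -/
theorem pi_card_ge_le {γ : Type*} [MeasurableSpace γ] (ν : Measure γ) [IsProbabilityMeasure ν]
    (E : Set γ) (n e : ℕ) :
    (Measure.pi fun _ : Fin n => ν) {z | e ≤ (Finset.univ.filter fun t => z t ∈ E).card} ≤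
      2 ^ n * ν E ^ e := by
  have hsub : {z : Fin n → γ | e ≤ (Finset.univ.filter fun t => z t ∈ E).card} ⊆
      ⋃ S ∈ (Finset.univ : Finset (Fin n)).powersetCard e,
        Set.pi Set.univ fun t => if t ∈ S then E else Set.univ := by
    intro z hz
    obtain ⟨S, hS, hcard⟩ := Finset.exists_subset_card_eq hz
    simp only [Set.mem_iUnion]
    refine ⟨S, by simp [Finset.mem_powersetCard, hcard], fun t _ => ?_⟩
    dsimp only
    split_ifs with ht
    · exact (Finset.mem_filter.mp (hS ht)).2
    · trivial
  refine (measure_mono hsub).trans ((measure_biUnion_finset_le _ _).trans ?_)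
  calc _ = ∑ _S ∈ (Finset.univ : Finset (Fin n)).powersetCard e, ν E ^ e := by
        refine Finset.sum_congr rfl fun S hS => ?_
        rw [Measure.pi_pi]
        have : ∀ t, ν (if t ∈ S then E else Set.univ) = if t ∈ S then ν E else 1 := by
          intro t; split_ifs <;> simp
        simp_rw [this]
        rw [Finset.prod_ite_mem, Finset.univ_inter, Finset.prod_const,
          (Finset.mem_powersetCard.mp hS).2]
    _ ≤ _ := by
        rw [Finset.sum_const, nsmul_eq_mul, Finset.card_powersetCard, Finset.card_univ,
          Fintype.card_fin]
        gcongr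
        exact_mod_cast Nat.choose_le_two_pow n e

end Counting

/-! ### Modulation, the aligned input of the eavesdropper, and hard decisions -/

section Signals

variable {K n F : ℕ} {V J : Type} [Fintype V] [DecidableEq V] [Fintype J] [DecidableEq J] {p : ℕ}

/-- Channel symbols: points of a `p × p` grid of Gaussian integers. -/
abbrev GridSym (p : ℕ) : Type := Fin p × Fin p

/-- A symbol as a pair of natural numbers. Sums of symbols, which leave the grid, are formed
there. -/
def natSym (a : GridSym p) : ℕ × ℕ := (a.1, a.2)

theorem natSym_injective : Function.Injective (natSym (p := p)) := by
  intro a b h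
  simp only [natSym, Prod.mk.injEq] at h
  exact Prod.ext (Fin.ext h.1) (Fin.ext h.2)

/-- The Gaussian integer with given real and imaginary parts. -/
noncomputable def gaussInt : ℕ × ℕ →+ ℂ where
  toFun q := q.1 + q.2 * Complex.I
  map_zero' := by simp
  map_add' a b := by simp; ring

theorem norm_gaussInt_natSym_le (a : GridSym p) : ‖gaussInt (natSym a)‖ ≤ 2 * p := by
  have h1 : (a.1 : ℝ) ≤ p := by exact_mod_cast a.1.2.le
  have h2 : (a.2 : ℝ) ≤ p := by exact_mod_cast a.2.2.le
  calc ‖gaussInt (natSym a)‖ ≤ ‖((a.1 : ℕ) : ℂ)‖ + ‖((a.2 : ℕ) : ℂ) * Complex.I‖ := norm_add_le _ _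
    _ = (a.1 : ℝ) + a.2 := by simp
    _ ≤ 2 * p := by linarith

/-- Data words of user `k`, who sends no data at the times `t` with `jam t = k`, when it is its turn
to jam. -/
abbrev DataWord (V : Type) (p : ℕ) (jam : Fin n → Fin K) (k : Fin K) : Type :=
  {t // jam t ≠ k} → V → GridSym p

/-- Jamming words of user `k`, sent at the times when it is its turn. -/
abbrev JamWord (J : Type) (p : ℕ) (jam : Fin n → Fin K) (k : Fin K) : Type :=
  {t // jam t = k} → J → GridSym p

variable {h : Channel K} (al : InterferenceAlignment h F V J) (jam : Fin n → Fin K)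

/-- The codeword that carries the data word `s` and the jamming word `r`, with amplitude `c`. -/
noncomputable def signal (c : ℝ) (k : Fin K) (s : DataWord V p jam k) (r : JamWord J p jam k) :
    Block n F := fun t f =>
  c * if ht : jam t = k then ∑ m, gaussInt (natSym (r ⟨t, ht⟩ m)) * al.jamDir m f
    else ∑ m, gaussInt (natSym (s ⟨t, ht⟩ m)) * al.dir m f

/-- The contribution of the data of user `k` to the coefficients of the jamming directions at the
eavesdropper. -/
def eveShare (k : Fin K) (s : DataWord V p jam k) : Fin n → J → ℕ × ℕ := fun t m' =>
  if ht : jam t = k then 0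
    else ∑ m, if al.shift k (jam t) m = m' then natSym (s ⟨t, ht⟩ m) else 0

/-- The coefficients of the jamming directions at the eavesdropper: at each time the symbols of the
jammer plus the data symbols that are aligned with them. -/
def eveInput (s : ∀ k, DataWord V p jam k) (r : Fin n → J → GridSym p) : Fin n → J → ℕ × ℕ :=
  fun t m => natSym (r t m) + ∑ k, eveShare al jam k (s k) t m

/-- What the eavesdropper receives, as a function of its aligned input and its noise. -/
noncomputable def eveOutput (c : ℝ) (u : Fin n → J → ℕ × ℕ) (z : Block n F) : Block n F :=
  fun t f => c * (∑ m, gaussInt (u t m) * (h none (jam t) f * al.jamDir m f)) + z t f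

theorem received_none_signal (c : ℝ) (s : ∀ k, DataWord V p jam k) (r : Fin n → J → GridSym p)
    (z : Block n F) :
    received h none (fun k => signal al jam c k (s k) fun t => r t) z =
      eveOutput al jam c (eveInput al jam s r) z := by
  funext t f
  have hk : ∀ k, h none k f * signal al jam c k (s k) (fun t => r t) t f =
      c * ∑ m, gaussInt ((if jam t = k then natSym (r t m) else 0) + eveShare al jam k (s k) t m) *
        (h none (jam t) f * al.jamDir m f) := by
    intro k
    unfold signal eveShare
    by_cases ht : jam t = k
    · subst ht
      simp only [dif_pos, if_true, add_zero, Finset.mul_sum]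
      exact Finset.sum_congr rfl fun m _ => by ring
    · simp only [dif_neg ht, if_neg ht, zero_add, map_sum, Finset.sum_mul]
      rw [Finset.sum_comm]
      have h1 : ∀ m, ∑ m', gaussInt (if al.shift k (jam t) m = m' then natSym (s k ⟨t, ht⟩ m)
          else 0) * (h none (jam t) f * al.jamDir m' f) =
          gaussInt (natSym (s k ⟨t, ht⟩ m)) * (h none k f * al.dir m f) := by
        intro m
        rw [al.dir_eq_jamDir k (jam t) (Ne.symm ht), Finset.sum_eq_single (al.shift k (jam t) m)]
        · simp
        · intro m' _ hm'
          simp [Ne.symm hm']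
        · simp
      simp_rw [h1, Finset.mul_sum]
      exact Finset.sum_congr rfl fun m _ => by ring
  unfold received eveOutput
  rw [Finset.sum_congr rfl fun k _ => hk k, ← Finset.mul_sum, Finset.sum_comm]
  congr 2
  refine Finset.sum_congr rfl fun m _ => ?_
  rw [← Finset.sum_mul, ← map_sum, Finset.sum_add_distrib]
  simp [eveInput]

/-- When it does not jam itself, a receiver sees its own data symbol in noise, free of
interference. -/
theorem proj_received_signal (c : ℝ) (s : ∀ k, DataWord V p jam k) (r : ∀ k, JamWord J p jam k)
    (z : Block n F) (i : Fin K) (t : Fin n) (ht : jam t ≠ i) (m : V) :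
    al.proj i m (received h (some i) (fun k => signal al jam c k (s k) (r k)) z t) =
      c * gaussInt (natSym (s i ⟨t, ht⟩ m)) + al.proj i m (z t) := by
  have h1 : received h (some i) (fun k => signal al jam c k (s k) (r k)) z t =
      (∑ k, fun f : Fin F => h (some i) k f * signal al jam c k (s k) (r k) t f) + z t := by
    funext f
    simp [received]
  rw [h1, map_add, map_sum, Finset.sum_eq_single i]
  · congr 1
    have h2 : (fun f : Fin F => h (some i) i f * signal al jam c i (s i) (r i) t f) =
        ∑ m', (c * gaussInt (natSym (s i ⟨t, ht⟩ m'))) •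
          fun f : Fin F => h (some i) i f * al.dir m' f := by
      funext f
      simp only [signal, dif_neg ht, Finset.sum_apply, Pi.smul_apply, smul_eq_mul, Finset.mul_sum]
      exact Finset.sum_congr rfl fun m _ => by ring
    rw [h2, map_sum]
    simp [al.proj_desired]
  · intro k _ hk
    by_cases htk : jam t = k
    · have h2 : (fun f : Fin F => h (some i) k f * signal al jam c k (s k) (r k) t f) =
          ∑ m', (c * gaussInt (natSym (r k ⟨t, htk⟩ m'))) •
            fun f : Fin F => h (some i) k f * al.jamDir m' f := by
        funext f
        simp only [signal, dif_pos htk, Finset.sum_apply, Pi.smul_apply, smul_eq_mul,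
          Finset.mul_sum]
        exact Finset.sum_congr rfl fun m _ => by ring
      rw [h2, map_sum]
      simp [al.proj_jamDir i k hk]
    · have h2 : (fun f : Fin F => h (some i) k f * signal al jam c k (s k) (r k) t f) =
          ∑ m', (c * gaussInt (natSym (s k ⟨t, htk⟩ m'))) •
            fun f : Fin F => h (some i) k f * al.dir m' f := by
        funext f
        simp only [signal, dif_neg htk, Finset.sum_apply, Pi.smul_apply, smul_eq_mul,
          Finset.mul_sum]
        exact Finset.sum_congr rfl fun m _ => by ring
      rw [h2, map_sum]
      simp [al.proj_dir i k hk]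
  · simp

theorem norm_signal_le (c H : ℝ) (hc : 0 ≤ c) (hdir : ∀ f, ∑ m, ‖al.dir m f‖ ≤ H)
    (hjam : ∀ f, ∑ m, ‖al.jamDir m f‖ ≤ H) (k : Fin K) (s : DataWord V p jam k)
    (r : JamWord J p jam k) (t : Fin n) (f : Fin F) :
    ‖signal al jam c k s r t f‖ ≤ c * (2 * p * H) := by
  unfold signal
  rw [norm_mul, Complex.norm_real, Real.norm_of_nonneg hc]
  gcongr
  split_ifs with ht
  · calc _ ≤ ∑ m, 2 * p * ‖al.jamDir m f‖ := by
          refine norm_sum_le_of_le _ fun m _ => ?_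
          rw [norm_mul]
          gcongr
          exact norm_gaussInt_natSym_le _
      _ ≤ _ := by rw [← Finset.mul_sum]; gcongr; exact hjam f
  · calc _ ≤ ∑ m, 2 * p * ‖al.dir m f‖ := by
          refine norm_sum_le_of_le _ fun m _ => ?_
          rw [norm_mul]
          gcongr
          exact norm_gaussInt_natSym_le _
      _ ≤ _ := by rw [← Finset.mul_sum]; gcongr; exact hdir f

/-- Rounding to `0, …, p - 1`. Values outside this range are reduced modulo `p`, or set to `0` if
they are negative; no statement depends on that choice. -/
noncomputable def quantize (p : ℕ) [NeZero p] (x : ℝ) : Fin p := Fin.ofNat p (round x).toNat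

theorem quantize_eq [NeZero p] (a : Fin p) (x : ℝ) (hx : |x - a| < 1 / 2) : quantize p x = a := by
  have : round x = (a : ℕ) := by
    rw [round_eq, Int.floor_eq_iff]
    rw [abs_lt] at hx
    push_cast
    constructor <;> linarith
  unfold quantize
  rw [this]
  ext
  simp

theorem measurable_quantize [NeZero p] : Measurable (quantize p) := by
  unfold quantize
  have h1 : Measurable fun x : ℝ => round x := by
    simp_rw [round_eq]
    fun_prop
  exact (Measurable.of_discrete (f := fun j : ℤ => Fin.ofNat p j.toNat)).comp h1

/-- Symbolwise hard decisions of receiver `i`. -/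
noncomputable def hardDecision [NeZero p] (c : ℝ) (i : Fin K) (y : Block n F) :
    DataWord V p jam i := fun t m =>
  (quantize p (al.proj i m (y t) / c).re, quantize p (al.proj i m (y t) / c).im)

theorem measurable_hardDecision [NeZero p] (c : ℝ) (i : Fin K) :
    Measurable (hardDecision (p := p) al jam c i) := by
  refine measurable_pi_lambda _ fun t => measurable_pi_lambda _ fun m => ?_
  have h1 : Measurable fun y : Block n F => al.proj i m (y t) / c := by
    have := (LinearMap.continuous_of_finiteDimensional (al.proj i m)).measurable
    exact (this.comp (measurable_pi_apply t.1)).div_const _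
  exact (measurable_quantize.comp (Complex.measurable_re.comp h1)).prodMk
    (measurable_quantize.comp (Complex.measurable_im.comp h1))

/-- The noise vectors that may cause a wrong decision at receiver `i`. -/
def badNoise (c : ℝ) (i : Fin K) : Set (Fin F → ℂ) := {ζ | ∃ m, c / 2 ≤ ‖al.proj i m ζ‖}

theorem hardDecision_received [NeZero p] (c : ℝ) (hc : 0 < c) (s : ∀ k, DataWord V p jam k)
    (r : ∀ k, JamWord J p jam k) (z : Block n F) (i : Fin K) (t : {t // jam t ≠ i})
    (hz : z t ∉ badNoise al c i) :
    hardDecision al jam c i (received h (some i) (fun k => signal al jam c k (s k) (r k)) z) t =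
      s i t := by
  funext m
  unfold hardDecision
  rw [proj_received_signal al jam c s r z i t t.2 m]
  simp only [badNoise, Set.mem_ofPred_eq, not_exists, not_le] at hz
  set ζ := al.proj i m (z t)
  have hζ : ‖ζ / c‖ < 1 / 2 := by
    rw [norm_div, Complex.norm_real, Real.norm_of_nonneg hc.le, div_lt_iff₀ hc]
    linarith [hz m]
  have hc' : (c : ℂ) ≠ 0 := by exact_mod_cast hc.ne'
  have heq : (c * gaussInt (natSym (s i t m)) + ζ) / c = gaussInt (natSym (s i t m)) + ζ / c := by
    field_simp
  have hre : (gaussInt (natSym (s i t m))).re = ((s i t m).1 : ℕ) := by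
    simp [gaussInt, natSym]
  have him : (gaussInt (natSym (s i t m))).im = ((s i t m).2 : ℕ) := by
    simp [gaussInt, natSym]
  rw [heq]
  refine Prod.ext (quantize_eq _ _ ?_) (quantize_eq _ _ ?_)
  · rw [Complex.add_re, hre, add_sub_cancel_left]
    exact (Complex.abs_re_le_norm _).trans_lt hζ
  · rw [Complex.add_im, him, add_sub_cancel_left]
    exact (Complex.abs_im_le_norm _).trans_lt hζ

end Signals

/-! ### Secrecy of the messages in the aligned input of the eavesdropper -/

section Secrecy

open scoped Classical

theorem finCondEntropy_nonneg {Ω α β : Type*} [Fintype Ω] (f : Ω → α) (g : Ω → β) :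
    0 ≤ finCondEntropy f g := by
  unfold finCondEntropy
  refine div_nonneg (Finset.sum_nonneg fun ω _ => Real.log_nonneg ?_) (by positivity)
  have h1 : (0 : ℝ) < fiberCard (fun ω => (f ω, g ω)) ω := by exact_mod_cast fiberCard_pos _ _
  rw [one_le_div h1]
  have : fiberCard (fun ω => (f ω, g ω)) ω ≤ fiberCard g ω := by
    refine Finset.card_le_card fun ω' hω' => ?_
    simp only [Finset.mem_filter, Finset.mem_univ, true_and, Prod.mk.injEq] at hω' ⊢
    exact hω'.2
  exact_mod_cast this

variable {K n F : ℕ} {V J : Type} [Fintype V] [DecidableEq V] [Fintype J] [DecidableEq J] {p : ℕ}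
  {h : Channel K} (al : InterferenceAlignment h F V J) (jam : Fin n → Fin K)

/-- The jammed word of user `k` that is left of the eavesdropper's aligned input once the data of
all other users are known. -/
def eveView (k : Fin K) (s : DataWord V p jam k) (r : Fin n → J → GridSym p) :
    Fin n → J → ℕ × ℕ :=
  fun t m => natSym (r t m) + eveShare al jam k s t m

theorem eveView_injective (k : Fin K) (s : DataWord V p jam k) :
    Function.Injective (eveView al jam k s) := by
  intro r r' hr
  funext t m
  exact natSym_injective (add_right_cancel (congrFun (congrFun hr t) m))

theorem eveShare_lt [NeZero p] (k : Fin K) (s : DataWord V p jam k) (t : Fin n) (m' : J) :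
    (eveShare al jam k s t m').1 < p ∧ (eveShare al jam k s t m').2 < p := by
  have hp : 0 < p := NeZero.pos p
  unfold eveShare
  split_ifs with ht
  · exact ⟨hp, hp⟩
  · by_cases hex : ∃ m, al.shift k (jam t) m = m'
    · obtain ⟨m, rfl⟩ := hex
      have hinj := al.shift_injective k (jam t) (Ne.symm ht)
      rw [Finset.sum_eq_single m]
      · simp only [if_true]
        exact ⟨(s ⟨t, ht⟩ m).1.2, (s ⟨t, ht⟩ m).2.2⟩
      · intro m1 _ hm1
        rw [if_neg fun h => hm1 (hinj h)]
      · simp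
    · push Not at hex
      rw [Finset.sum_eq_zero fun m _ => if_neg (hex m)]
      exact ⟨hp, hp⟩

/-- A finite set that contains all values of `eveView`: coordinates less than `2 * p`. -/
def eveViewRange (n : ℕ) (J : Type) [Fintype J] [DecidableEq J] (p : ℕ) :
    Finset (Fin n → J → ℕ × ℕ) :=
  Fintype.piFinset fun _ => Fintype.piFinset fun _ => Finset.range (2 * p) ×ˢ Finset.range (2 * p)

/-- A sum of one data symbol and one jamming symbol stays in a grid only four times as large,
which is why uniform jamming symbols of the same size hide all but a bounded amount per symbol. -/
theorem eveView_mem [NeZero p] (k : Fin K) (s : DataWord V p jam k) (r : Fin n → J → GridSym p) :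
    eveView al jam k s r ∈ eveViewRange n J p := by
  unfold eveViewRange
  simp only [Fintype.mem_piFinset, Finset.mem_product, Finset.mem_range]
  intro t m
  have h1 := eveShare_lt al jam k s t m
  have h2 := (r t m).1.2
  have h3 := (r t m).2.2
  simp only [eveView, natSym, Prod.fst_add, Prod.snd_add]
  omega

theorem card_eveViewRange :
    (eveViewRange n J p).card =
      4 ^ (Fintype.card J * n) * Fintype.card (Fin n → J → GridSym p) := by
  simp only [eveViewRange, Fintype.card_piFinset, Finset.card_product, Finset.card_range,
    Finset.prod_const, Finset.card_univ, Fintype.card_fin, Fintype.card_pi, Fintype.card_prod]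
  rw [← pow_mul, ← pow_mul, ← mul_pow]
  congr 1
  ring

/-- Another code word lies within Hamming distance `2 * e` of the word with index `i`. -/
def IsCrowded {k : Fin K} {M B : ℕ} (c : Fin M × Fin B → DataWord V p jam k) (e : ℕ)
    (i : Fin M × Fin B) : Prop :=
  ∃ i', i' ≠ i ∧ hammingDist (c i) (c i') ≤ 2 * e

/-- A code for user `k` of `M` messages with `B` words each: few words have another word close by,
and an observer of the jammed word alone learns a bounded amount about the message as soon as `B`
is at least `4 ^ (|J| * n)`. -/
theorem exists_user_code [NeZero p] (k : Fin K) (M B e : ℕ) [NeZero M] [NeZero B] :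
    ∃ c : Fin M × Fin B → DataWord V p jam k,
      ((Finset.univ.filter fun i => IsCrowded jam c e i).card : ℝ) ≤
        2 * ((M * B : ℝ) ^ 2 * (2 ^ Fintype.card {t // jam t ≠ k} *
          ((p * p : ℝ) ^ Fintype.card V) ^ (2 * e)) /
          ((p * p : ℝ) ^ Fintype.card V) ^ Fintype.card {t // jam t ≠ k}) ∧
      Real.log M - Real.log (2 * (1 + 4 ^ (Fintype.card J * n) / (B : ℝ))) ≤
        finCondEntropy (fun ω : Fin M × Fin B × (Fin n → J → GridSym p) => ω.1)
          (fun ω => eveView al jam k (c (ω.1, ω.2.1)) ω.2.2) := by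
  have hq : 0 < Fintype.card (V → GridSym p) := Fintype.card_pos
  have hv : 0 < 2 ^ Fintype.card {t // jam t ≠ k} * Fintype.card (V → GridSym p) ^ (2 * e) :=
    Nat.mul_pos (pow_pos two_pos _) (pow_pos hq _)
  have hball : ∀ x : DataWord V p jam k,
      (Finset.univ.filter fun x' => hammingDist x x' ≤ 2 * e).card ≤
        2 ^ Fintype.card {t // jam t ≠ k} * Fintype.card (V → GridSym p) ^ (2 * e) :=
    fun x => card_hammingBall_le x (2 * e)
  obtain ⟨c, h1, h2⟩ := exists_secret_code (W := Fin M) (B := Fin B) (eveView al jam k)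
    (eveView_injective al jam k) (eveViewRange n J p) (eveView_mem al jam k)
    (fun x x' : DataWord V p jam k => hammingDist x x' ≤ 2 * e) _ hv
    (fun x => by convert hball x)
  have hcardV : (Fintype.card (V → GridSym p) : ℝ) = (p * p : ℝ) ^ Fintype.card V := by
    rw [Fintype.card_fun, Fintype.card_prod, Fintype.card_fin]
    push_cast
    rfl
  have hcardD : (Fintype.card (DataWord V p jam k) : ℝ) =
      ((p * p : ℝ) ^ Fintype.card V) ^ Fintype.card {t // jam t ≠ k} := by
    rw [Fintype.card_fun, Nat.cast_pow, hcardV]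
  refine ⟨c, ?_, ?_⟩
  · rw [hcardD, Fintype.card_fin, Fintype.card_fin, Nat.cast_mul, Nat.cast_pow, Nat.cast_pow,
      hcardV, Nat.cast_ofNat] at h1
    unfold IsCrowded
    convert h1
  · have : (Fintype.card (Fin n → J → GridSym p) : ℝ) ≠ 0 := by
      exact_mod_cast Fintype.card_ne_zero
    rw [card_eveViewRange, Nat.cast_mul, mul_div_mul_right _ _ this, Fintype.card_fin,
      Fintype.card_fin, Nat.cast_pow, Nat.cast_ofNat] at h2
    exact h2

/-- Separates user `k` from the others in the sample space of messages, private randomness of the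
encoders, and jamming. -/
def splitUser {M B : ℕ} (R : Type) (k : Fin K) : (Fin K → Fin M) × (Fin K → Fin B) × R ≃
    (Fin M × Fin B × R) × ({j // j ≠ k} → Fin M × Fin B) where
  toFun ω := ((ω.1 k, ω.2.1 k, ω.2.2), fun j => (ω.1 j, ω.2.1 j))
  invFun x := (fun j => if hj : j = k then x.1.1 else (x.2 ⟨j, hj⟩).1,
    fun j => if hj : j = k then x.1.2.1 else (x.2 ⟨j, hj⟩).2, x.1.2.2)
  left_inv ω := by
    refine Prod.ext (funext fun j => ?_) (Prod.ext (funext fun j => ?_) rfl)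
    · by_cases hj : j = k
      · subst hj; simp
      · simp [hj]
    · by_cases hj : j = k
      · subst hj; simp
      · simp [hj]
  right_inv x := by
    refine Prod.ext (by simp) (funext fun j => ?_)
    simp [j.2]

variable {M B : ℕ} [NeZero M] [NeZero B] [NeZero p]
  (code : ∀ k : Fin K, Fin M × Fin B → DataWord V p jam k)

/-- To an eavesdropper that knows the data of all other users, the aligned input is worth as much as
the jammed word of user `k`: the shares of the others can be subtracted. -/
theorem finCondEntropy_message (k : Fin K) :
    finCondEntropy
      (fun ω : (Fin K → Fin M) × (Fin K → Fin B) × (Fin n → J → GridSym p) => ω.1 k)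
      (fun ω => (eveInput al jam (fun j => code j (ω.1 j, ω.2.1 j)) ω.2.2,
        fun j : {j // j ≠ k} => (ω.1 j, ω.2.1 j))) =
    finCondEntropy (fun ω : Fin M × Fin B × (Fin n → J → GridSym p) => ω.1)
      (fun ω => eveView al jam k (code k (ω.1, ω.2.1)) ω.2.2) := by
  rw [← finCondEntropy_prod (Ω' := {j // j ≠ k} → Fin M × Fin B)
      (fun ω : Fin M × Fin B × (Fin n → J → GridSym p) => ω.1)
      (fun ω => eveView al jam k (code k (ω.1, ω.2.1)) ω.2.2),
    ← finCondEntropy_comp_equiv (splitUser (M := M) (B := B) (Fin n → J → GridSym p) k)]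
  have hsplit : ∀ (ω : (Fin K → Fin M) × (Fin K → Fin B) × (Fin n → J → GridSym p)) t m,
      eveInput al jam (fun j => code j (ω.1 j, ω.2.1 j)) ω.2.2 t m =
        eveView al jam k (code k (ω.1 k, ω.2.1 k)) ω.2.2 t m +
          ∑ j : {j // j ≠ k}, eveShare al jam j (code j (ω.1 j, ω.2.1 j)) t m := by
    intro ω t m
    unfold eveInput eveView
    rw [add_assoc]
    congr 1
    rw [Fintype.sum_eq_add_sum_subtype_ne _ k]
  refine finCondEntropy_congr (fun ω ω' => ?_) (fun ω ω' _ => Iff.rfl)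
  simp only [splitUser, Equiv.coe_fn_mk, Prod.mk.injEq]
  refine and_congr_left fun hoth => ?_
  have hoth' : ∀ t m, ∑ j : {j // j ≠ k}, eveShare al jam j (code j (ω'.1 j, ω'.2.1 j)) t m =
      ∑ j : {j // j ≠ k}, eveShare al jam j (code j (ω.1 j, ω.2.1 j)) t m := by
    intro t m
    refine Finset.sum_congr rfl fun j _ => ?_
    rw [congrFun hoth j]
  constructor
  · intro hu
    funext t m
    have := congrFun (congrFun hu t) m
    rw [hsplit, hsplit, hoth'] at this
    exact add_right_cancel this
  · intro hv
    funext t m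
    rw [hsplit, hsplit, hoth', congrFun (congrFun hv t) m]

/-- Chain rule: the messages of a set of users are jointly hidden from the eavesdropper if each of
them is hidden from an eavesdropper that knows the data of all the other users. -/
theorem card_mul_le_finCondEntropy (l : ℝ)
    (hl : ∀ k, l ≤ finCondEntropy (fun ω : Fin M × Fin B × (Fin n → J → GridSym p) => ω.1)
      (fun ω => eveView al jam k (code k (ω.1, ω.2.1)) ω.2.2)) (S : Finset (Fin K)) :
    S.card * l ≤ finCondEntropy
      (fun (ω : (Fin K → Fin M) × (Fin K → Fin B) × (Fin n → J → GridSym p)) (k : S) => ω.1 k)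
      (fun ω => eveInput al jam (fun j => code j (ω.1 j, ω.2.1 j)) ω.2.2) := by
  induction S using Finset.induction_on with
  | empty => simpa using finCondEntropy_nonneg _ _
  | insert k S hk ih =>
    rw [Finset.card_insert_of_notMem hk]
    set U := fun ω : (Fin K → Fin M) × (Fin K → Fin B) × (Fin n → J → GridSym p) =>
      eveInput al jam (fun j => code j (ω.1 j, ω.2.1 j)) ω.2.2
    have h1 : finCondEntropy (fun (ω : (Fin K → Fin M) × (Fin K → Fin B) × (Fin n → J → GridSym p))
        (j : (insert k S : Finset (Fin K))) => ω.1 j) U =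
        finCondEntropy (fun ω => ((fun j : S => ω.1 j), ω.1 k)) U := by
      refine finCondEntropy_congr (fun _ _ => Iff.rfl) (fun ω ω' _ => ?_)
      simp only [Prod.mk.injEq]
      constructor
      · intro h
        exact ⟨funext fun j => congrFun h ⟨j, Finset.mem_insert_of_mem j.2⟩,
          congrFun h ⟨k, Finset.mem_insert_self k S⟩⟩
      · rintro ⟨h2, h3⟩
        funext ⟨j, hj⟩
        rcases Finset.mem_insert.mp hj with rfl | hj
        · exact h3
        · exact congrFun h2 ⟨j, hj⟩
    rw [h1, finCondEntropy_prodMk]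
    have h2 := finCondEntropy_anti
      (fun ω : (Fin K → Fin M) × (Fin K → Fin B) × (Fin n → J → GridSym p) => ω.1 k)
      (g := fun ω => ((fun j : S => ω.1 j), U ω))
      (g' := fun ω => (U ω, fun j : {j // j ≠ k} => (ω.1 j, ω.2.1 j))) (by
        intro ω ω' h
        simp only [Prod.mk.injEq] at h ⊢
        refine ⟨funext fun j => ?_, h.1⟩
        have hj : (j : Fin K) ≠ k := fun h => hk (h ▸ j.2)
        exact (Prod.ext_iff.mp (congrFun h.2 ⟨j, hj⟩)).1)
    rw [finCondEntropy_message al jam code k] at h2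
    have h3 := hl k
    push_cast
    linarith

end Secrecy

/-! ### Codebooks with rotating jammers -/

section UniformMeasure

theorem uniformOn_univ_singleton {α : Type*} [Fintype α] [MeasurableSpace α]
    [MeasurableSingletonClass α] (a : α) :
    uniformOn (Set.univ : Set α) {a} = (Fintype.card α : ENNReal)⁻¹ := by
  rw [uniformOn_univ, Measure.count_singleton, one_div]

theorem lintegral_uniformOn_univ {α : Type*} [Fintype α] [MeasurableSpace α]
    [MeasurableSingletonClass α] (f : α → ENNReal) :
    ∫⁻ a, f a ∂(uniformOn (Set.univ : Set α)) = ∑ a, f a / Fintype.card α := by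
  rw [lintegral_fintype]
  exact Finset.sum_congr rfl fun a _ => by rw [uniformOn_univ_singleton, div_eq_mul_inv]

theorem pi_uniformOn_univ {ι : Type*} [Fintype ι] {X : ι → Type*} [∀ i, Fintype (X i)]
    [∀ i, Nonempty (X i)]
    [∀ i, MeasurableSpace (X i)] [∀ i, MeasurableSingletonClass (X i)] :
    (Measure.pi fun i => uniformOn (Set.univ : Set (X i))) =
      uniformOn (Set.univ : Set (∀ i, X i)) := by
  classical
  refine Measure.ext_of_singleton fun x => ?_
  rw [uniformOn_univ_singleton, Measure.pi_singleton]
  simp_rw [uniformOn_univ_singleton]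
  rw [Fintype.card_pi, Nat.cast_prod, ENNReal.prod_inv_distrib]
  intro i _ j _ _
  exact Or.inr (by simp)

end UniformMeasure

section CodebookConstruction

variable {K n F : ℕ} {V J : Type} [Fintype V] [DecidableEq V] [Fintype J] [DecidableEq J] {p : ℕ}
  [NeZero p] {h : Channel K} (al : InterferenceAlignment h F V J) (jam : Fin n → Fin K)

open scoped Classical in
/-- Bounded distance decoding: the message of some code word within distance `e`, and `0` if there
is none. -/
noncomputable def decodeWord {k : Fin K} {M B : ℕ} [NeZero M]
    (c : Fin M × Fin B → DataWord V p jam k) (e : ℕ) (x : DataWord V p jam k) : Fin M :=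
  if hx : ∃ i, hammingDist (c i) x ≤ e then (Classical.choose hx).1 else 0

theorem decodeWord_eq {k : Fin K} {M B : ℕ} [NeZero M] (c : Fin M × Fin B → DataWord V p jam k)
    (e : ℕ) (x : DataWord V p jam k) (i : Fin M × Fin B) (hi : ¬ IsCrowded jam c e i)
    (hx : hammingDist (c i) x ≤ e) : decodeWord jam c e x = i.1 := by
  have hex : ∃ i, hammingDist (c i) x ≤ e := ⟨i, hx⟩
  unfold decodeWord
  rw [dif_pos hex]
  by_contra hne
  refine hi ⟨Classical.choose hex, fun heq => hne (by rw [heq]), ?_⟩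
  have h1 := Classical.choose_spec hex
  have h2 := hammingDist_triangle (c i) x (c (Classical.choose hex))
  rw [hammingDist_comm x] at h2
  omega

instance : NeZero ((M : ℕ+) : ℕ) := ⟨M.ne_zero⟩

/-- The codebook in which the transmitters take turns, according to `jam`, in sending jamming
symbols instead of data. The private randomness of encoder `k` is uniform: the index in `Fin B` of a
word for its message, and its jamming word. -/
noncomputable def jamCodebook (ρ c : ℝ) (M : ℕ+) (B : ℕ) [NeZero B]
    (code : ∀ k, Fin M × Fin B → DataWord V p jam k) (e : ℕ)
    (hpow : ∀ k s r, (1 / ((n : ℝ) * F)) * ∑ f, ∑ t, ‖signal (p := p) al jam c k s r t f‖ ^ 2 ≤ ρ) :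
    Codebook K n F ρ where
  M := fun _ => M
  enc := fun k w => (uniformOn (Set.univ : Set (Fin B × JamWord J p jam k))).map
    fun ω => signal al jam c k (code k (w, ω.1)) ω.2
  enc_prob := fun k w => Measure.isProbabilityMeasure_map (Measurable.of_discrete).aemeasurable
  power := fun k w => by
    rw [ae_map_iff (Measurable.of_discrete).aemeasurable]
    · exact Eventually.of_forall fun ω => hpow k _ _
    · apply measurableSet_le _ measurable_const
      fun_prop
  dec := fun k y => decodeWord jam (code k) e (hardDecision al jam c k y)
  dec_meas := fun k =>
    (Measurable.of_discrete (f := decodeWord jam (code k) e)).comp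
      (measurable_hardDecision al jam c k)

/-- As exactly one user jams at each time, the jamming words of all users are one word for all
times. -/
def glueJam (J : Type) (p B : ℕ) (jam : Fin n → Fin K) :
    (∀ k, Fin B × JamWord J p jam k) ≃ (Fin K → Fin B) × (Fin n → J → GridSym p) where
  toFun ω := (fun k => (ω k).1, fun t => (ω (jam t)).2 ⟨t, rfl⟩)
  invFun x := fun k => (x.1 k, fun t => x.2 t)
  left_inv ω := by
    funext k
    refine Prod.ext rfl (funext fun ⟨t, ht⟩ => ?_)
    subst ht
    rfl
  right_inv x := rfl

variable {ρ c : ℝ} {M : ℕ+} {B : ℕ} [NeZero B] {code : ∀ k, Fin M × Fin B → DataWord V p jam k}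
  {e : ℕ}
  {hpow : ∀ k s r, (1 / ((n : ℝ) * F)) * ∑ f, ∑ t, ‖signal (p := p) al jam c k s r t f‖ ^ 2 ≤ ρ}

theorem measurable_received (i : Observer K) :
    Measurable fun q : (Fin K → Block n F) × Block n F => received h i q.1 q.2 := by
  unfold received
  fun_prop

theorem outputLaw_jamCodebook (i : Observer K) (w : Fin K → Fin M) (A : Set (Block n F))
    (hA : MeasurableSet A) :
    (jamCodebook al jam ρ c M B code e hpow).outputLaw h i w A =
      ∑ ω : (Fin K → Fin B) × (Fin n → J → GridSym p),
        noiseLaw n F {z | received h i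
          (fun k => signal al jam c k (code k (w k, ω.1 k)) fun t => ω.2 t) z ∈ A} /
          Fintype.card ((Fin K → Fin B) × (Fin n → J → GridSym p)) := by
  unfold Codebook.outputLaw
  rw [Measure.map_apply (measurable_received i) hA,
    Measure.prod_apply (measurable_received i hA)]
  have henc : (Measure.pi fun k => (jamCodebook al jam ρ c M B code e hpow).enc k (w k)) =
      (uniformOn (Set.univ : Set (∀ k, Fin B × JamWord J p jam k))).map
        fun ω k => signal al jam c k (code k (w k, (ω k).1)) (ω k).2 := by
    rw [← pi_uniformOn_univ]
    exact (Measure.pi_map_pi (μ := fun k => uniformOn (Set.univ : Set (Fin B × JamWord J p jam k)))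
      (f := fun k ω => signal al jam c k (code k (w k, ω.1)) ω.2)
      fun k => (Measurable.of_discrete).aemeasurable).symm
  rw [henc, lintegral_map (measurable_measure_prodMk_left (measurable_received i hA))
    Measurable.of_discrete, lintegral_uniformOn_univ,
    Fintype.card_congr (glueJam J p B jam), ← (glueJam J p B jam).symm.sum_comp]
  rfl

end CodebookConstruction

/-! ### Equivocation and error probability -/

section CodebookPerformance

variable {K n F : ℕ} {V J : Type} [Fintype V] [DecidableEq V] [Fintype J] [DecidableEq J] {p : ℕ}
  [NeZero p] {h : Channel K} (al : InterferenceAlignment h F V J) (jam : Fin n → Fin K)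
  {ρ c : ℝ} {M : ℕ+} {B : ℕ} [NeZero B] {code : ∀ k, Fin M × Fin B → DataWord V p jam k}
  {e : ℕ}
  {hpow : ∀ k s r, (1 / ((n : ℝ) * F)) * ∑ f, ∑ t, ‖signal (p := p) al jam c k s r t f‖ ^ 2 ≤ ρ}

theorem measurable_eveOutput (u : Fin n → J → ℕ × ℕ) :
    Measurable (eveOutput al jam c u) := by
  unfold eveOutput
  fun_prop

/-- Messages and eavesdropper output are a noisy function of data that are uniform on a finite
set. -/
theorem jointLaw_jamCodebook (S : Finset (Fin K)) (a : S → Fin M) (A : Set (Block n F))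
    (hA : MeasurableSet A) :
    (jamCodebook al jam ρ c M B code e hpow).jointLaw h none
      (Prod.snd ⁻¹' A ∩ (jamCodebook al jam ρ c M B code e hpow).messagesOf S ⁻¹' {a}) =
    ∑ ω : (Fin K → Fin M) × (Fin K → Fin B) × (Fin n → J → GridSym p),
      if (fun k : S => ω.1 k) = a then
        ((noiseLaw n F).map (eveOutput al jam c
          (eveInput al jam (fun j => code j (ω.1 j, ω.2.1 j)) ω.2.2))) A /
          Fintype.card ((Fin K → Fin M) × (Fin K → Fin B) × (Fin n → J → GridSym p)) else 0 := by
  have hmsg : Measurable ((jamCodebook al jam ρ c M B code e hpow).messagesOf S) := by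
    refine measurable_pi_lambda _ fun k => ?_
    exact (measurable_pi_apply _).comp measurable_fst
  have hs : MeasurableSet (Prod.snd ⁻¹' A ∩
      (jamCodebook al jam ρ c M B code e hpow).messagesOf S ⁻¹' {a}) :=
    (measurable_snd hA).inter (hmsg (measurableSet_singleton a))
  unfold Codebook.jointLaw
  have : IsProbabilityMeasure (uniformOn
      (Set.univ : Set (jamCodebook al jam ρ c M B code e hpow).Messages)) :=
    isProbabilityMeasure_uniformOn Set.finite_univ Set.univ_nonempty
  rw [Measure.compProd_apply hs, lintegral_uniformOn_univ, Fintype.sum_prod_type]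
  refine Finset.sum_congr rfl fun w _ => ?_
  by_cases hw : (jamCodebook al jam ρ c M B code e hpow).messagesOf S (w, 0) = a
  · have hset : Prod.mk w ⁻¹' (Prod.snd ⁻¹' A ∩
        (jamCodebook al jam ρ c M B code e hpow).messagesOf S ⁻¹' {a}) = A := by
      ext y
      simp only [Set.mem_preimage, Set.mem_inter_iff]
      exact and_iff_left hw
    have hker := outputLaw_jamCodebook al jam (ρ := ρ) (c := c) (code := code) (e := e)
      (hpow := hpow) none w A hA
    rw [hset]
    refine (congrArg (· / _) hker).trans ?_
    dsimp only
    rw [div_eq_mul_inv, Finset.sum_mul]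
    refine Finset.sum_congr rfl fun ω _ => ?_
    refine Eq.trans ?_ (if_pos hw).symm
    rw [Measure.map_apply (measurable_eveOutput al jam _) hA, Fintype.card_prod (Fin K → Fin M),
      Nat.cast_mul, div_eq_mul_inv, div_eq_mul_inv, mul_assoc]
    congr 1
    · congr 1
      ext z
      simp only [Set.mem_preimage]
      rw [← received_none_signal]
      rfl
    · rw [mul_comm, ENNReal.mul_inv (Or.inr (ENNReal.natCast_ne_top _))
        (Or.inl (ENNReal.natCast_ne_top _))]
      rfl
  · have hset : Prod.mk w ⁻¹' (Prod.snd ⁻¹' A ∩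
        (jamCodebook al jam ρ c M B code e hpow).messagesOf S ⁻¹' {a}) = ∅ := by
      ext y
      simp only [Set.mem_preimage, Set.mem_inter_iff, Set.mem_empty_iff_false,
        iff_false, not_and]
      exact fun _ => hw
    rw [hset, measure_empty, ENNReal.zero_div]
    exact (Finset.sum_eq_zero fun ω _ => if_neg hw).symm

/-- Secrecy from an eavesdropper that observes the aligned input without noise, and knows the data
of the other users, implies a large equivocation at the true one. -/
theorem equivocation_jamCodebook (l ε : ℝ) (hε0 : 0 ≤ ε) (hε : ε ≤ 1)
    (hl : ∀ k, l ≤ finCondEntropy (fun ω : Fin M × Fin B × (Fin n → J → GridSym p) => ω.1)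
      (fun ω => eveView al jam k (code k (ω.1, ω.2.1)) ω.2.2))
    (hlε : (1 - ε) * Real.log M ≤ l) (S : Finset (Fin K)) :
    1 - ε ≤ (jamCodebook al jam ρ c M B code e hpow).equivocation h S := by
  unfold Codebook.equivocation
  split_ifs with h0
  · linarith
  · set C := jamCodebook al jam ρ c M B code e hpow with hC
    have hlog2 : 0 < Real.log 2 := Real.log_pos one_lt_two
    have hmsg : Measurable (C.messagesOf S) := by
      refine measurable_pi_lambda _ fun k => ?_
      exact (measurable_pi_apply _).comp measurable_fst
    have hN : ∀ u, IsProbabilityMeasure ((noiseLaw n F).map (eveOutput al jam c u)) := fun u =>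
      Measure.isProbabilityMeasure_map (measurable_eveOutput al jam u).aemeasurable
    have h1 := finCondEntropy_le_condEntropyBits (C.jointLaw h none) (C.messagesOf S) Prod.snd hmsg
      measurable_snd
      (fun (ω : (Fin K → Fin M) × (Fin K → Fin B) × (Fin n → J → GridSym p)) (k : S) => ω.1 k)
      (fun ω => eveInput al jam (fun j => code j (ω.1 j, ω.2.1 j)) ω.2.2)
      (fun u => (noiseLaw n F).map (eveOutput al jam c u))
      (fun a A hA => by
        refine (jointLaw_jamCodebook al jam (code := code) (e := e) (hpow := hpow)
          S a A hA).trans ?_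
        refine Finset.sum_congr rfl fun ω _ => ?_
        split_ifs with h1 h2 h2
        · rfl
        · exact absurd h1 h2
        · exact absurd h2 h1
        · rfl)
    have h2 := card_mul_le_finCondEntropy al jam code l hl S
    have h3 := entropyBits_le (C.jointLaw h none) (C.messagesOf S) hmsg
    have h4 : Real.log (Fintype.card (∀ k : S, Fin (C.M k))) = S.card * Real.log M := by
      have : Fintype.card (∀ k : S, Fin (C.M k)) = (M : ℕ) ^ S.card := by
        simp [hC, jamCodebook]
      rw [this, Nat.cast_pow, Real.log_pow]
    rw [h4] at h3
    have h5 : 0 < entropyBits (C.jointLaw h none) (C.messagesOf S) := by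
      refine lt_of_le_of_ne ?_ (Ne.symm h0)
      unfold entropyBits
      have : IsProbabilityMeasure ((C.jointLaw h none).map (C.messagesOf S)) :=
        Measure.isProbabilityMeasure_map hmsg.aemeasurable
      exact div_nonneg (Finset.sum_nonneg fun a _ =>
        Real.negMulLog_nonneg measureReal_nonneg measureReal_le_one) hlog2.le
    rw [le_div_iff₀ h5]
    calc (1 - ε) * entropyBits (C.jointLaw h none) (C.messagesOf S)
        ≤ (1 - ε) * (S.card * Real.log M / Real.log 2) := by gcongr
      _ = S.card * ((1 - ε) * Real.log M) / Real.log 2 := by ring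
      _ ≤ S.card * l / Real.log 2 := by gcongr
      _ ≤ _ := (div_le_div_of_nonneg_right h2 hlog2.le).trans h1

theorem real_outputLaw_jamCodebook (i : Observer K) (w : Fin K → Fin M) (A : Set (Block n F))
    (hA : MeasurableSet A) :
    ((jamCodebook al jam ρ c M B code e hpow).outputLaw h i w).real A =
      ∑ ω : (Fin K → Fin B) × (Fin n → J → GridSym p),
        (noiseLaw n F).real {z | received h i
          (fun k => signal al jam c k (code k (w k, ω.1 k)) fun t => ω.2 t) z ∈ A} /
          Fintype.card ((Fin K → Fin B) × (Fin n → J → GridSym p)) := by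
  rw [measureReal_def, outputLaw_jamCodebook al jam i w A hA, ENNReal.toReal_sum]
  · refine Finset.sum_congr rfl fun ω _ => ?_
    rw [ENNReal.toReal_div, ENNReal.toReal_natCast, measureReal_def]
  · intro ω _
    exact ENNReal.div_ne_top (measure_ne_top _ _) (by exact_mod_cast Fintype.card_ne_zero)

open scoped Classical in
theorem hammingDist_hardDecision_le (hc : 0 < c) (s : ∀ k, DataWord V p jam k)
    (r : ∀ k, JamWord J p jam k) (z : Block n F) (k : Fin K) :
    hammingDist (s k) (hardDecision al jam c k
      (received h (some k) (fun k => signal al jam c k (s k) (r k)) z)) ≤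
      (Finset.univ.filter fun t => z t ∈ badNoise al c k).card := by
  unfold hammingDist
  refine Finset.card_le_card_of_injOn (fun t => t.1) ?_ (fun a _ b _ hab => Subtype.ext hab)
  intro t ht
  simp only [Finset.coe_filter, Finset.mem_univ, true_and, Set.mem_ofPred_eq] at ht ⊢
  by_contra hbad
  exact ht (hardDecision_received al jam c hc s r z k t hbad).symm

open scoped Classical in
theorem errorProb_jamCodebook_le (hc : 0 < c) (k : Fin K) :
    (jamCodebook al jam ρ c M B code e hpow).errorProb h k ≤
      ((Finset.univ.filter fun i => IsCrowded jam (code k) e i).card : ℝ) / (M * B) +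
        2 ^ n * ((Measure.pi fun _ : Fin F => stdComplexGaussian).real (badNoise al c k)) ^ e := by
  set C := jamCodebook al jam ρ c M B code e hpow with hC
  set τ := (Measure.pi fun _ : Fin F => stdComplexGaussian).real (badNoise al c k)
  set N : ℝ := (Fintype.card ((Fin K → Fin B) × (Fin n → J → GridSym p)) : ℝ) with hNdef
  have hN : 0 < N := by
    have : 0 < Fintype.card ((Fin K → Fin B) × (Fin n → J → GridSym p)) := Fintype.card_pos
    rw [hNdef]
    exact_mod_cast this
  let crowd : Fin M × Fin B → ℝ := fun i => if IsCrowded jam (code k) e i then 1 else 0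
  -- a decoding error needs a crowded code word or many corrupted symbols
  have hz : ∀ (w : Fin K → Fin M) (ω : (Fin K → Fin B) × (Fin n → J → GridSym p)),
      (noiseLaw n F).real {z | received h (some k)
        (fun k => signal al jam c k (code k (w k, ω.1 k)) fun t => ω.2 t) z ∈
          {y | C.dec k y ≠ w k}} ≤ crowd (w k, ω.1 k) + 2 ^ n * τ ^ e := by
    intro w ω
    have hτ : 0 ≤ τ := measureReal_nonneg
    by_cases hcr : IsCrowded jam (code k) e (w k, ω.1 k)
    · simp only [crowd, if_pos hcr]
      have : (noiseLaw n F).real {z | received h (some k)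
        (fun k => signal al jam c k (code k (w k, ω.1 k)) fun t => ω.2 t) z ∈
          {y | C.dec k y ≠ w k}} ≤ 1 := measureReal_le_one
      have : 0 ≤ 2 ^ n * τ ^ e := by positivity
      linarith
    · simp only [crowd, if_neg hcr, zero_add]
      have hsub : {z | received h (some k)
          (fun k => signal al jam c k (code k (w k, ω.1 k)) fun t => ω.2 t) z ∈
          {y | C.dec k y ≠ w k}} ⊆
          {z : Block n F | e ≤ (Finset.univ.filter fun t => z t ∈ badNoise al c k).card} := by
        intro z hz
        simp only [Set.mem_ofPred_eq] at hz ⊢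
        by_contra hlt
        refine hz (decodeWord_eq jam (code k) e _ (w k, ω.1 k) hcr ?_)
        exact (hammingDist_hardDecision_le al jam hc (fun k => code k (w k, ω.1 k))
          (fun k t => ω.2 t) z k).trans (not_le.mp hlt).le
      refine (measureReal_mono hsub).trans ?_
      have h1 := pi_card_ge_le (Measure.pi fun _ : Fin F => stdComplexGaussian)
        (badNoise al c k) n e
      have h2 := ENNReal.toReal_mono (by finiteness) h1
      rw [ENNReal.toReal_mul, ENNReal.toReal_pow, ENNReal.toReal_pow, ENNReal.toReal_ofNat] at h2
      exact h2
  have hsum : ∑ w : Fin K → Fin M, ∑ ω : (Fin K → Fin B) × (Fin n → J → GridSym p),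
      crowd (w k, ω.1 k) / N =
      ((M : ℕ) : ℝ) ^ K * (((Finset.univ.filter fun i => IsCrowded jam (code k) e i).card : ℝ) /
        (M * B)) := by
    have hM0 : ((M : ℕ) : ℝ) ≠ 0 := by simp
    have hB0 : (B : ℝ) ≠ 0 := by simp [NeZero.ne B]
    have h1 : ∀ m : Fin M, ∑ ω : (Fin K → Fin B) × (Fin n → J → GridSym p), crowd (m, ω.1 k) / N =
        (∑ b, crowd (m, b)) / B := by
      intro m
      rw [Fintype.sum_prod_type]
      simp only [Finset.sum_const, Finset.card_univ, nsmul_eq_mul]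
      rw [← Finset.mul_sum, ← Finset.sum_div]
      have h2 := card_mul_sum_apply (I := Fin K) k fun b : Fin B => crowd (m, b)
      have h3 : N = (Fintype.card (Fin K → Fin B) : ℝ) * Fintype.card (Fin n → J → GridSym p) := by
        rw [hNdef, Fintype.card_prod, Nat.cast_mul]
      have h4 : (Fintype.card (Fin n → J → GridSym p) : ℝ) ≠ 0 := by
        exact_mod_cast Fintype.card_ne_zero
      have h5 : (Fintype.card (Fin K → Fin B) : ℝ) ≠ 0 := by
        exact_mod_cast Fintype.card_ne_zero
      rw [Fintype.card_fin] at h2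
      rw [h3]
      field_simp
      linarith
    have h2 := card_mul_sum_apply (I := Fin K) k fun m : Fin M => (∑ b, crowd (m, b)) / B
    simp_rw [h1]
    have hS : ∑ m, ∑ b, crowd (m, b) = ∑ i, crowd i := (Fintype.sum_prod_type _).symm
    simp only [← Finset.sum_div] at h2 ⊢
    rw [Fintype.card_fin, Fintype.card_fun, Fintype.card_fin, Fintype.card_fin, hS] at h2
    have h3 : ∑ i, crowd i =
        ((Finset.univ.filter fun i => IsCrowded jam (code k) e i).card : ℝ) := by
      simp only [crowd, Finset.sum_boole]
    rw [h3] at h2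
    push_cast at h2
    field_simp at h2 ⊢
    linarith
  have hM0 : (0 : ℝ) < ((M : ℕ) : ℝ) ^ K := by
    have : (0 : ℝ) < ((M : ℕ) : ℝ) := by exact_mod_cast M.pos
    positivity
  have hprod : ∏ j, (C.M j : ℝ) = ((M : ℕ) : ℝ) ^ K := by
    simp [hC, jamCodebook]
  unfold Codebook.errorProb
  rw [hprod, one_div, inv_mul_le_iff₀ hM0, mul_add, ← hsum]
  have hmeas : ∀ w : Fin K → Fin M, MeasurableSet {y | C.dec k y ≠ w k} := fun w =>
    (C.dec_meas k) (measurableSet_singleton (w k)).compl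
  calc ∑ w : Fin K → Fin M, (C.outputLaw h (some k) w).real {y | C.dec k y ≠ w k}
      ≤ ∑ w : Fin K → Fin M, ∑ ω : (Fin K → Fin B) × (Fin n → J → GridSym p),
          (crowd (w k, ω.1 k) + 2 ^ n * τ ^ e) / N := by
        refine Finset.sum_le_sum fun w _ => ?_
        rw [real_outputLaw_jamCodebook al jam (some k) w _ (hmeas w)]
        refine Finset.sum_le_sum fun ω _ => ?_
        gcongr
        exact hz w ω
    _ = _ := by
        simp_rw [add_div, Finset.sum_add_distrib]
        congr 1
        simp only [Finset.sum_const, Finset.card_univ, nsmul_eq_mul, Fintype.card_fun,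
          Fintype.card_fin]
        rw [← hNdef]
        push_cast
        field_simp

end CodebookPerformance

/-! ### Achievability at a fixed power -/

section FixedPower

/-- Round robin: the times are divided equally among the `K` users. -/
def roundRobin (K m : ℕ) (t : Fin (K * m)) : Fin K := (finProdFinEquiv.symm t).1

theorem card_roundRobin_ne (K m : ℕ) (k : Fin K) :
    Fintype.card {t // roundRobin K m t ≠ k} = (K - 1) * m := by
  let e : {t // roundRobin K m t ≠ k} ≃ {i : Fin K // i ≠ k} × Fin m :=
    { toFun := fun t => (⟨(finProdFinEquiv.symm t.1).1, t.2⟩, (finProdFinEquiv.symm t.1).2)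
      invFun := fun x => ⟨finProdFinEquiv (x.1.1, x.2), by
        unfold roundRobin; rw [Equiv.symm_apply_apply]; exact x.1.2⟩
      left_inv := fun t => Subtype.ext (finProdFinEquiv.apply_symm_apply t.1)
      right_inv := fun x => by simp }
  rw [Fintype.card_congr e, Fintype.card_prod, Fintype.card_fin]
  simp

variable {K F : ℕ} {V J : Type} [Fintype V] [DecidableEq V] [Fintype J] [DecidableEq J]
  {h : Channel K} (al : InterferenceAlignment h F V J)

open scoped Classical in
/-- Repeating `n₁` times the parameters of a block of `K * l` times, with `μ` messages per user,
gives codebooks with exactly the same rate, and error probability and leakage both tending to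
zero. Here `hcode` bounds, for one block, the expected number of code words close to a given one,
and `hnoise` the chance of too many noise events; both are at most one half and get raised to the
power `n₁`. -/
theorem rateEquivocationAchievable_of_alignment (hK : 2 ≤ K) (hF : 0 < F) (ρ c H : ℝ) (hc : 0 < c)
    (p l : ℕ) [NeZero p] (hl : 0 < l) (μ : ℕ) (hμ : 2 ≤ μ)
    (hdir : ∀ f, ∑ m, ‖al.dir m f‖ ≤ H) (hjam : ∀ f, ∑ m, ‖al.jamDir m f‖ ≤ H) (hρ : 0 ≤ ρ)
    (hpower : c * (2 * p * H) ≤ √ρ)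
    (hcode : 2 * (μ * 4 ^ (Fintype.card J * (K * l)) * (2 ^ ((K - 1) * l) *
      ((p * p : ℝ) ^ Fintype.card V) ^ (2 * (K - 1)))) ≤
        ((p * p : ℝ) ^ Fintype.card V) ^ ((K - 1) * l))
    (hnoise : ∀ k, 2 * (2 ^ (K * l) *
      ((Measure.pi fun _ : Fin F => stdComplexGaussian).real (badNoise al c k)) ^ (K - 1)) ≤ 1) :
    RateEquivocationAchievable h ρ (fun _ => Real.logb 2 μ / (K * l * F)) 1 := by
  intro ε hε
  have hlogμ : 0 < Real.log μ := Real.log_pos (by exact_mod_cast hμ)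
  have hε' : 0 < min ε 1 := lt_min hε one_pos
  obtain ⟨n₁, hn₁pos, hn₁ε, hn₁μ⟩ : ∃ n₁ : ℕ, 0 < n₁ ∧ 3 * (1 / 2 : ℝ) ^ n₁ ≤ ε ∧
      Real.log 4 ≤ min ε 1 * (n₁ * Real.log μ) := by
    have h1 : ∀ᶠ n₁ : ℕ in atTop, 3 * (1 / 2 : ℝ) ^ n₁ ≤ ε := by
      have : Tendsto (fun n : ℕ => 3 * (1 / 2 : ℝ) ^ n) atTop (𝓝 (3 * 0)) :=
        (tendsto_pow_atTop_nhds_zero_of_lt_one (by norm_num) (by norm_num)).const_mul _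
      rw [mul_zero] at this
      exact (this.eventually_lt_const hε).mono fun _ h => h.le
    have h2 : ∀ᶠ n₁ : ℕ in atTop, Real.log 4 / (min ε 1 * Real.log μ) ≤ n₁ :=
      tendsto_natCast_atTop_atTop.eventually_ge_atTop _
    obtain ⟨n₁, h0, h1, h2⟩ := ((eventually_gt_atTop 0).and (h1.and h2)).exists
    refine ⟨n₁, h0, h1, ?_⟩
    rw [div_le_iff₀ (by positivity)] at h2
    linarith
  set m := l * n₁
  have hm : 0 < m := Nat.mul_pos hl hn₁pos
  have hKm : 0 < K * m := Nat.mul_pos (by omega) hm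
  let jam := roundRobin K m
  let M : ℕ+ := ⟨μ ^ n₁, by positivity⟩
  -- enough words per message to make up for the growth of the grid by addition of symbols
  let B : ℕ := 4 ^ (Fintype.card J * (K * m))
  have hB0 : B ≠ 0 := by positivity
  have : NeZero B := ⟨hB0⟩
  -- the code corrects wrong decisions at a fraction `1 / l` of the times with data
  let e := (K - 1) * n₁
  have hcodes := fun k => exists_user_code (p := p) al jam k (M : ℕ) B e
  choose code hcrowd hsecret using hcodes
  have hpow : ∀ k s r, (1 / (((K * m : ℕ) : ℝ) * F)) *
      ∑ f, ∑ t, ‖signal (p := p) al jam c k s r t f‖ ^ 2 ≤ ρ := by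
    intro k s r
    have h1 : ∀ f t, ‖signal (p := p) al jam c k s r t f‖ ^ 2 ≤ ρ := by
      intro f t
      have := (norm_signal_le al jam c H hc.le hdir hjam k s r t f).trans hpower
      calc _ ≤ √ρ ^ 2 := by gcongr
        _ = ρ := Real.sq_sqrt hρ
    have h2 : ∑ f : Fin F, ∑ t : Fin (K * m), ‖signal (p := p) al jam c k s r t f‖ ^ 2 ≤
        ∑ _f : Fin F, ∑ _t : Fin (K * m), ρ :=
      Finset.sum_le_sum fun f _ => Finset.sum_le_sum fun t _ => h1 f t
    simp only [Finset.sum_const, Finset.card_univ, Fintype.card_fin, nsmul_eq_mul] at h2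
    have hKm' : (0 : ℝ) < ((K * m : ℕ) : ℝ) := by exact_mod_cast hKm
    have hF' : (0 : ℝ) < F := by exact_mod_cast hF
    rw [one_div, inv_mul_le_iff₀ (by positivity)]
    linarith
  refine ⟨K * m, F, hKm, hF, jamCodebook al jam ρ c M B code e hpow, fun k => ?_, fun k => ?_,
    fun S => ?_⟩
  · have hM : (((jamCodebook al jam ρ c M B code e hpow).M k : ℕ) : ℝ) = (μ : ℝ) ^ n₁ := by
      simp [jamCodebook, M]
    rw [hM, Real.logb_pow]
    have h1 : (n₁ : ℝ) ≠ 0 := by exact_mod_cast hn₁pos.ne'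
    have h2 : (l : ℝ) ≠ 0 := by exact_mod_cast hl.ne'
    have h3 : (K : ℝ) ≠ 0 := by positivity
    have h4 : (F : ℝ) ≠ 0 := by positivity
    simp only [m]
    push_cast
    field_simp
  · refine (errorProb_jamCodebook_le al jam hc k).trans ?_
    set q := (p * p : ℝ) ^ Fintype.card V
    set τ := (Measure.pi fun _ : Fin F => stdComplexGaussian).real (badNoise al c k)
    have hq : 0 < q := by
      have : (0 : ℝ) < p := by exact_mod_cast NeZero.pos p
      positivity
    have hL : Fintype.card {t // jam t ≠ k} = (K - 1) * m := card_roundRobin_ne K m k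
    have hM : ((M : ℕ) : ℝ) = (μ : ℝ) ^ n₁ := by simp [M]
    have hMpos : (0 : ℝ) < (M : ℕ) := by exact_mod_cast M.pos
    have hBpos : (0 : ℝ) < B := by exact_mod_cast NeZero.pos B
    have h1 := hcrowd k
    rw [hL] at h1
    -- the expected number of code words close to a given one decays exponentially
    have h2 : (M * B : ℝ) * (2 ^ ((K - 1) * m) * q ^ (2 * e)) / q ^ ((K - 1) * m) ≤
        (1 / 2) ^ n₁ := by
      have h3 : (μ * 4 ^ (Fintype.card J * (K * l)) * (2 ^ ((K - 1) * l) *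
          q ^ (2 * (K - 1)))) / q ^ ((K - 1) * l) ≤ 1 / 2 := by
        rw [div_le_iff₀ (by positivity)]
        linarith
      have h4 := pow_le_pow_left₀ (by positivity) h3 n₁
      refine le_trans (le_of_eq ?_) h4
      rw [hM]
      simp only [B, m, e, div_pow, mul_pow, ← pow_mul, Nat.cast_pow, Nat.cast_ofNat]
      congr 2
      · congr 2
        ring
      · congr 2 <;> ring
      · ring
    have h5 : (2 : ℝ) ^ (K * m) * τ ^ e ≤ (1 / 2) ^ n₁ := by
      have h6 : 2 ^ (K * l) * τ ^ (K - 1) ≤ 1 / 2 := by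
        have := hnoise k
        linarith
      have h7 := pow_le_pow_left₀ (by positivity) h6 n₁
      refine le_trans (le_of_eq ?_) h7
      simp only [m, e, mul_pow, ← pow_mul, ← mul_assoc]
    have h8 : ((Finset.univ.filter fun i => IsCrowded jam (code k) e i).card : ℝ) / (M * B) ≤
        2 * (1 / 2) ^ n₁ := by
      rw [div_le_iff₀ (by positivity)]
      refine h1.trans ?_
      calc _ = 2 * ((M * B : ℝ) * (2 ^ ((K - 1) * m) * q ^ (2 * e)) / q ^ ((K - 1) * m)) *
            (M * B) := by ring
        _ ≤ _ := by gcongr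
    exact (add_le_add h8 h5).trans (by linarith)
  · have h1 : 1 - min ε 1 ≤ (jamCodebook al jam ρ c M B code e hpow).equivocation h S := by
      refine equivocation_jamCodebook al jam _ _ hε'.le (min_le_right _ _) hsecret ?_ S
      have h2 : (4 : ℝ) ^ (Fintype.card J * (K * m)) / (B : ℝ) = 1 := by
        simp only [B]
        push_cast
        exact div_self (by positivity)
      rw [h2]
      have hM : ((M : ℕ) : ℝ) = (μ : ℝ) ^ n₁ := by simp [M]
      rw [hM, Real.log_pow]
      norm_num
      linarith
    linarith [min_le_left ε 1]

end FixedPower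

/-! ### Asymptotics of large power -/

section Asymptotics

variable {K F : ℕ} {V J : Type} [Fintype V] [DecidableEq V] [Fintype J] [DecidableEq J]
  {h : Channel K}

theorem tendsto_measureReal_badNoise (al : InterferenceAlignment h F V J)
    (ν : Measure (Fin F → ℂ)) [IsFiniteMeasure ν] (i : Fin K) :
    Tendsto (fun c : ℝ => ν.real (badNoise al c i)) atTop (𝓝 0) := by
  have hanti : Antitone fun c : ℝ => badNoise al c i := fun c c' hcc' ζ ⟨m, hm⟩ =>
    ⟨m, le_trans (by linarith) hm⟩
  have hmeas : ∀ c, MeasurableSet (badNoise al c i) := by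
    intro c
    have : badNoise al c i = ⋃ m, {ζ | c / 2 ≤ ‖al.proj i m ζ‖} := by
      ext ζ
      simp [badNoise]
    rw [this]
    refine MeasurableSet.iUnion fun m => measurableSet_le measurable_const ?_
    exact (LinearMap.continuous_of_finiteDimensional (al.proj i m)).measurable.norm
  have hempty : ⋂ c : ℝ, badNoise al c i = ∅ := by
    refine Set.eq_empty_of_forall_notMem fun ζ hζ => ?_
    obtain ⟨m, hm⟩ := Set.mem_iInter.mp hζ (2 * ∑ m, ‖al.proj i m ζ‖ + 2)
    have := Finset.single_le_sum (f := fun m => ‖al.proj i m ζ‖) (fun m _ => norm_nonneg _)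
      (Finset.mem_univ m)
    linarith
  have := tendsto_measure_iInter_atTop (μ := ν) (fun c => (hmeas c).nullMeasurableSet) hanti
    ⟨0, measure_ne_top _ _⟩
  rw [hempty, measure_empty] at this
  simpa [measureReal_def, Function.comp_def] using
    (ENNReal.tendsto_toReal ENNReal.zero_ne_top).comp this

theorem tendsto_logb_floor_rpow_div {a : ℝ} (ha : 0 < a) :
    Tendsto (fun ρ : ℝ => Real.logb 2 ⌊ρ ^ a⌋₊ / Real.logb 2 ρ) atTop (𝓝 a) := by
  have hlog : Tendsto (fun ρ : ℝ => Real.logb 2 ρ) atTop atTop :=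
    Real.tendsto_logb_atTop one_lt_two
  have hlow : Tendsto (fun ρ : ℝ => a - 1 / Real.logb 2 ρ) atTop (𝓝 a) := by
    simpa using tendsto_const_nhds.sub (tendsto_const_nhds.div_atTop (a := (1 : ℝ)) hlog)
  refine tendsto_of_tendsto_of_tendsto_of_le_of_le' hlow tendsto_const_nhds ?_ ?_
  all_goals
    filter_upwards [eventually_gt_atTop 1, (tendsto_rpow_atTop ha).eventually_ge_atTop 2]
      with ρ hρ hρa
    have hpos : 0 < Real.logb 2 ρ := Real.logb_pos one_lt_two hρ
    have h1 : (0 : ℝ) < ⌊ρ ^ a⌋₊ := by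
      exact_mod_cast Nat.floor_pos.mpr (by linarith)
    have h2 : Real.logb 2 (ρ ^ a) = a * Real.logb 2 ρ :=
      Real.logb_rpow_eq_mul_logb_of_pos (by linarith)
  · rw [le_div_iff₀ hpos, sub_mul, one_div, inv_mul_cancel₀ hpos.ne', ← h2]
    have h3 : ρ ^ a / 2 ≤ ⌊ρ ^ a⌋₊ := by
      have := Nat.lt_floor_add_one (ρ ^ a)
      linarith
    have h4 := Real.logb_le_logb_of_le one_lt_two (by linarith) h3
    rwa [Real.logb_div (by linarith) two_ne_zero, Real.logb_self_eq_one one_lt_two] at h4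
  · rw [div_le_iff₀ hpos, ← h2]
    exact Real.logb_le_logb_of_le one_lt_two h1 (Nat.floor_le (by linarith))

/-- Any `a` below `|V| (K - 1)`, the number of complex data symbols per round of `K` times, gives
a rate with `a / (K F)` degrees of freedom. Grids with `ρ ^ (2 b)` points, `b < 1 / 2`, leave a
distance between their points that tends to infinity with the power `ρ`. -/
theorem exists_rate_of_alignment (al : InterferenceAlignment h F V J) (hK : 2 ≤ K) (hF : 0 < F)
    {a : ℝ} (ha : 0 < a) (haV : a < Fintype.card V * (K - 1)) :
    ∃ R : ℝ → ℝ, (∀ᶠ ρ in atTop, RateEquivocationAchievable h ρ (fun _ => R ρ) 1) ∧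
      Tendsto (fun ρ => R ρ / Real.logb 2 ρ) atTop (𝓝 (a / (K * F))) := by
  set D : ℝ := Fintype.card V * (K - 1) with hD
  have hD0 : 0 < D := ha.trans haV
  -- the block length `l` and the exponent `b < 1 / 2` of the grid size make up for the gap `D - a`
  obtain ⟨l, hl2, hl⟩ : ∃ l : ℕ, 2 < l ∧ 2 * D / (D - a) < l :=
    ((eventually_gt_atTop 2).and
      (tendsto_natCast_atTop_atTop.eventually_gt_atTop (2 * D / (D - a)))).exists
  rw [div_lt_iff₀ (by linarith)] at hl
  have hl2' : (2 : ℝ) < l := by exact_mod_cast hl2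
  have hl2'' : (0 : ℝ) < l - 2 := by linarith
  obtain ⟨b, hb1, hb2⟩ : ∃ b : ℝ, a * l / (2 * D * (l - 2)) < b ∧ b < 1 / 2 := by
    refine exists_between ?_
    rw [div_lt_iff₀ (by positivity)]
    nlinarith
  have hb0 : 0 < b := lt_of_le_of_lt (by positivity) hb1
  rw [div_lt_iff₀ (by positivity)] at hb1
  -- a bound for the gain of the modulator, positive in any case
  set H : ℝ := 1 + ∑ f : Fin F, (∑ m, ‖al.dir m f‖ + ∑ m, ‖al.jamDir m f‖) with hH
  have hHf : ∀ f : Fin F, ∑ m, ‖al.dir m f‖ + ∑ m, ‖al.jamDir m f‖ ≤ H := fun f => by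
    have := Finset.single_le_sum
      (f := fun f : Fin F => ∑ m, ‖al.dir m f‖ + ∑ m, ‖al.jamDir m f‖)
      (fun f _ => by positivity) (Finset.mem_univ f)
    linarith
  have hH0 : 0 < H := by positivity
  have hal : 0 < a * l := by positivity
  refine ⟨fun ρ => Real.logb 2 ⌊ρ ^ (a * l)⌋₊ / (K * l * F), ?_, ?_⟩
  swap
  · have h1 := (tendsto_logb_floor_rpow_div hal).div_const (K * l * F : ℝ)
    have h2 : a * l / (K * l * F) = a / (K * F) := by
      have : (l : ℝ) ≠ 0 := by positivity
      have : (K : ℝ) ≠ 0 := by positivity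
      have : (F : ℝ) ≠ 0 := by positivity
      field_simp
    rw [h2] at h1
    exact h1.congr fun ρ => by ring
  -- the distance between grid points grows with the power
  have hc : Tendsto (fun ρ : ℝ => √ρ / (2 * ⌈ρ ^ b⌉₊ * H)) atTop atTop := by
    have h1 : Tendsto (fun ρ : ℝ => ρ ^ (1 / 2 - b) / (4 * H)) atTop atTop :=
      (tendsto_rpow_atTop (by linarith)).atTop_div_const (by positivity)
    refine tendsto_atTop_mono' _ ?_ h1
    filter_upwards [eventually_ge_atTop 1] with ρ hρ
    have h2 : 1 ≤ ρ ^ b := Real.one_le_rpow hρ hb0.le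
    have h3 : (⌈ρ ^ b⌉₊ : ℝ) ≤ 2 * ρ ^ b := by
      have := Nat.ceil_lt_add_one (a := ρ ^ b) (by linarith)
      linarith
    have h4 : (0 : ℝ) < ⌈ρ ^ b⌉₊ := by exact_mod_cast Nat.ceil_pos.mpr (by linarith)
    rw [Real.rpow_sub (by linarith), ← Real.sqrt_eq_rpow, div_div]
    refine div_le_div_of_nonneg_left (Real.sqrt_nonneg _) (by positivity) ?_
    nlinarith [mul_le_mul_of_nonneg_right h3 hH0.le]
  have hnoise : ∀ᶠ ρ : ℝ in atTop, ∀ k, 2 * (2 ^ (K * l) *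
      ((Measure.pi fun _ : Fin F => stdComplexGaussian).real
        (badNoise al (√ρ / (2 * ⌈ρ ^ b⌉₊ * H)) k)) ^ (K - 1)) ≤ 1 := by
    refine eventually_all.mpr fun k => ?_
    have h1 := ((((tendsto_measureReal_badNoise al
      (Measure.pi fun _ : Fin F => stdComplexGaussian) k).comp hc).pow (K - 1)).const_mul
        ((2 : ℝ) ^ (K * l))).const_mul 2
    rw [zero_pow (by omega), mul_zero, mul_zero] at h1
    exact (h1.eventually_lt_const one_pos).mono fun _ h => h.le
  set C : ℝ := 2 * (4 ^ (Fintype.card J * (K * l)) * 2 ^ ((K - 1) * l)) with hC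
  have hcode : ∀ᶠ ρ : ℝ in atTop, C ≤ ρ ^ (b * (2 * D * (l - 2)) - a * l) :=
    (tendsto_rpow_atTop (by linarith)).eventually_ge_atTop _
  filter_upwards [hnoise, hcode, hc.eventually_gt_atTop 0, eventually_ge_atTop 1,
    (tendsto_rpow_atTop hal).eventually_ge_atTop 2] with ρ hnoise hcode hc hρ1 hμ
  have hρ0 : 0 < ρ := by linarith
  have hp : (0 : ℝ) < ⌈ρ ^ b⌉₊ := by
    exact_mod_cast Nat.ceil_pos.mpr (Real.rpow_pos_of_pos hρ0 b)
  have : NeZero ⌈ρ ^ b⌉₊ := ⟨by exact_mod_cast hp.ne'⟩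
  refine rateEquivocationAchievable_of_alignment al hK hF ρ _ H hc ⌈ρ ^ b⌉₊ l (by omega) _
    (Nat.le_floor (by exact_mod_cast hμ)) (fun f => le_trans ?_ (hHf f))
    (fun f => le_trans ?_ (hHf f)) hρ0.le (div_mul_cancel₀ _ (by positivity)).le ?_ hnoise
  · exact le_add_of_nonneg_right (by positivity)
  · exact le_add_of_nonneg_left (by positivity)
  · set p : ℝ := (⌈ρ ^ b⌉₊ : ℝ)
    have hpb : ρ ^ b ≤ p := Nat.le_ceil _
    have hl' : (K - 1) * l = (K - 1) * (l - 2) + 2 * (K - 1) := by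
      obtain ⟨l', rfl⟩ := Nat.exists_eq_add_of_le hl2.le
      simp
      ring
    have h1 : C * ⌊ρ ^ (a * l)⌋₊ ≤ ((p * p) ^ Fintype.card V) ^ ((K - 1) * (l - 2)) := by
      calc C * ⌊ρ ^ (a * l)⌋₊ ≤ ρ ^ (b * (2 * D * (l - 2)) - a * l) * ρ ^ (a * l) := by
            gcongr
            exact Nat.floor_le (by positivity)
        _ = ρ ^ (b * (2 * D * (l - 2))) := by
            rw [← Real.rpow_add hρ0]; congr 1; ring
        _ = ((ρ ^ b * ρ ^ b) ^ Fintype.card V) ^ ((K - 1) * (l - 2)) := by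
            rw [← Real.rpow_add hρ0, ← Real.rpow_mul_natCast hρ0.le,
              ← Real.rpow_mul_natCast hρ0.le]
            congr 1
            rw [hD]
            push_cast [Nat.cast_sub (by omega : 1 ≤ K), Nat.cast_sub hl2.le]
            ring
        _ ≤ _ := by gcongr
    have h2 : 0 ≤ ((p * p) ^ Fintype.card V) ^ (2 * (K - 1)) := by positivity
    calc _ = C * ⌊ρ ^ (a * l)⌋₊ * ((p * p) ^ Fintype.card V) ^ (2 * (K - 1)) := by
          rw [hC]; ring
      _ ≤ ((p * p) ^ Fintype.card V) ^ ((K - 1) * (l - 2)) *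
          ((p * p) ^ Fintype.card V) ^ (2 * (K - 1)) := by gcongr
      _ = ((p * p) ^ Fintype.card V) ^ ((K - 1) * l) := by
          rw [← pow_add, ← hl']

/-- A single message has no errors and nothing to hide. -/
theorem rateEquivocationAchievable_zero (h : Channel K) {ρ : ℝ} (hρ : 0 < ρ) :
    RateEquivocationAchievable h ρ (fun _ => 0) 1 := by
  intro ε hε
  let C : Codebook K 1 1 ρ :=
    { M := fun _ => 1
      enc := fun _ _ => Measure.dirac 0
      enc_prob := fun _ _ => inferInstance
      power := fun _ _ => by
        rw [ae_dirac_eq]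
        simp [hρ.le]
      dec := fun _ _ => 0
      dec_meas := fun _ => measurable_const }
  have hsub : ∀ k, Subsingleton (Fin (C.M k)) := fun k => inferInstanceAs (Subsingleton (Fin 1))
  refine ⟨1, 1, one_pos, one_pos, C, fun k => ?_, fun k => ?_, fun S => ?_⟩
  · simp [C]
  · have : C.errorProb h k = 0 := by
      unfold Codebook.errorProb
      have : ∀ w : C.Messages, {y | C.dec k y ≠ w k} = ∅ := fun w =>
        Set.eq_empty_of_forall_notMem fun y hy => hy ((hsub k).elim _ _)
      simp [this]
    rw [this]
    exact hε.le
  · have hent : entropyBits (C.jointLaw h none) (C.messagesOf S) = 0 := by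
      unfold entropyBits
      have : ∀ a : (∀ k : S, Fin (C.M k)),
          ((C.jointLaw h none).map (C.messagesOf S)).real {a} = 1 := by
        intro a
        have huniv : ({a} : Set (∀ k : S, Fin (C.M k))) = Set.univ :=
          Set.eq_univ_of_forall fun b => funext fun k => (hsub k).elim _ _
        have hmsg : Measurable (C.messagesOf S) :=
          measurable_pi_lambda _ fun k => (measurable_pi_apply _).comp measurable_fst
        have := Measure.isProbabilityMeasure_map (μ := C.jointLaw h none) hmsg.aemeasurable
        rw [huniv, probReal_univ]
      simp [this]
    unfold Codebook.equivocation
    rw [if_pos hent]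
    linarith

/-- Rates whose degrees of freedom are within `δ` of `η` for large power, for each `δ` separately,
can be merged into one rate function with the limit `η`: a nearly optimal rate is taken at each
power. -/
theorem secureDoFAchievable_of_eventually {h : Channel K} {η : ℝ}
    (happrox : ∀ δ : ℝ, 0 < δ → ∀ᶠ ρ in atTop, ∃ r : ℝ,
      RateEquivocationAchievable h ρ (fun _ => r) 1 ∧ |r / Real.logb 2 ρ - η| ≤ δ) :
    SecureDoFAchievable h η := by
  have hex : ∀ ρ : ℝ, ∃ r : ℝ, 0 < ρ → RateEquivocationAchievable h ρ (fun _ => r) 1 ∧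
      ∀ r', RateEquivocationAchievable h ρ (fun _ => r') 1 →
        |r / Real.logb 2 ρ - η| ≤ |r' / Real.logb 2 ρ - η| + ρ⁻¹ := by
    intro ρ
    by_cases hρ : 0 < ρ
    swap
    · exact ⟨0, fun h => absurd h hρ⟩
    set s := (fun r : ℝ => |r / Real.logb 2 ρ - η|) ''
      {r | RateEquivocationAchievable h ρ (fun _ => r) 1} with hs
    have hne : s.Nonempty := ⟨_, 0, rateEquivocationAchievable_zero h hρ, rfl⟩
    have hbdd : BddBelow s := ⟨0, by rintro _ ⟨r, _, rfl⟩; exact abs_nonneg _⟩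
    obtain ⟨_, ⟨r, hr, rfl⟩, hlt⟩ := Real.lt_sInf_add_pos hne (inv_pos.mpr hρ)
    refine ⟨r, fun _ => ⟨hr, fun r' hr' => hlt.le.trans ?_⟩⟩
    gcongr
    exact csInf_le hbdd ⟨r', hr', rfl⟩
  choose R hR using hex
  refine ⟨R, fun ρ hρ => (hR ρ hρ).1, ?_⟩
  rw [Metric.tendsto_nhds]
  intro δ hδ
  have hinv : ∀ᶠ ρ : ℝ in atTop, ρ⁻¹ < δ / 2 :=
    tendsto_inv_atTop_zero.eventually_lt_const (by positivity)
  filter_upwards [happrox (δ / 2) (by positivity), hinv, eventually_gt_atTop 0] with ρ h1 h2 hρ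
  obtain ⟨r, hr, hle⟩ := h1
  rw [Real.dist_eq]
  linarith [(hR ρ hρ).2 r hr]

/-- Asymptotically, data directions fill half of the slots. -/
theorem tendsto_card_div_slots (K : ℕ) :
    Tendsto (fun N : ℕ => (Fintype.card (CrossLink K → Fin N) : ℝ) / slots K N) atTop
      (𝓝 (1 / 2)) := by
  have h1 : Tendsto (fun N : ℕ => 1 / (1 + (1 + 3 / (N : ℝ)) ^ Fintype.card (CrossLink K)))
      atTop (𝓝 (1 / (1 + (1 + 0) ^ Fintype.card (CrossLink K)))) := by
    refine tendsto_const_nhds.div (tendsto_const_nhds.add ((tendsto_const_nhds.add ?_).pow _))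
      (by positivity)
    exact tendsto_const_div_atTop_nhds_zero_nat 3
  rw [show (1 : ℝ) / (1 + (1 + 0) ^ Fintype.card (CrossLink K)) = 1 / 2 by norm_num] at h1
  refine h1.congr' ?_
  filter_upwards [eventually_gt_atTop 0] with N hN
  have hN' : (0 : ℝ) < N := by exact_mod_cast hN
  simp only [slots, Fintype.card_sum, Fintype.card_fun, Fintype.card_fin]
  push_cast
  rw [show 1 + 3 / (N : ℝ) = (N + 3) / N by field_simp, div_pow]
  field_simp

theorem secureDoFAchievable_of_alignments {h : Channel K} (hK : 1 ≤ K)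
    (hal : ∀ N, Nonempty
      (InterferenceAlignment h (slots K N) (CrossLink K → Fin N) (CrossLink K → Fin (N + 2)))) :
    SecureDoFAchievable h (((K : ℝ) - 1) / (2 * K)) := by
  refine secureDoFAchievable_of_eventually fun δ hδ => ?_
  obtain rfl | hK2 := hK.eq_or_lt
  · filter_upwards [eventually_gt_atTop 0] with ρ hρ
    exact ⟨0, rateEquivocationAchievable_zero h hρ, by simpa using hδ.le⟩
  have hK0 : (0 : ℝ) < K := by positivity
  have hK1 : (0 : ℝ) < K - 1 := by
    have : (2 : ℝ) ≤ K := by exact_mod_cast hK2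
    linarith
  -- the factor `N / (N + 1)` keeps the rate strictly below the number of data directions
  have hlim : Tendsto (fun N : ℕ => ((Fintype.card (CrossLink K → Fin N) : ℝ) * (K - 1) *
      ((N : ℝ) / (N + 1))) / (K * slots K N)) atTop (𝓝 (((K : ℝ) - 1) / (2 * K))) := by
    have h1 := ((tendsto_card_div_slots K).mul (tendsto_natCast_div_add_atTop (1 : ℝ))).mul_const
      (((K : ℝ) - 1) / K)
    rw [show (1 : ℝ) / 2 * 1 * ((K - 1) / K) = (K - 1) / (2 * K) by field_simp] at h1
    exact h1.congr fun N => by ring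
  obtain ⟨N, hN0, hN⟩ := ((eventually_gt_atTop 0).and
    (Metric.tendsto_nhds.mp hlim (δ / 2) (by positivity))).exists
  have hN0' : (0 : ℝ) < N := by exact_mod_cast hN0
  have hcard : (0 : ℝ) < Fintype.card (CrossLink K → Fin N) := by
    have : NeZero N := ⟨hN0.ne'⟩
    exact_mod_cast Fintype.card_pos
  have hslots : 0 < slots K N := by
    unfold slots
    rw [Fintype.card_sum]
    have : 0 < Fintype.card (CrossLink K → Fin N) := by exact_mod_cast hcard
    omega
  obtain ⟨al⟩ := hal N
  obtain ⟨R, hR, hRlim⟩ := exists_rate_of_alignment al hK2 hslots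
    (a := Fintype.card (CrossLink K → Fin N) * (K - 1) * ((N : ℝ) / (N + 1)))
    (by positivity)
    (mul_lt_of_lt_one_right (by positivity) ((div_lt_one (by positivity)).mpr (by linarith)))
  filter_upwards [hR, Metric.tendsto_nhds.mp hRlim (δ / 2) (by positivity)] with ρ h1 h2
  refine ⟨R ρ, h1, ?_⟩
  rw [← Real.dist_eq]
  refine (dist_triangle _ _ _).trans ((add_lt_add h2 hN).le.trans (by linarith))

end Asymptotics

theorem mainTheorem2 {Ω : Type*} [MeasurableSpace Ω] (P : Measure Ω) [IsProbabilityMeasure P]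
    (K : ℕ) (hK : 1 ≤ K) (h : Ω → Channel K)
    (h_meas : ∀ i k f, Measurable fun ω => h ω i k f)
    (h_cont : ∀ T : Finset (Observer K × Fin K × ℕ),
      P.map (fun ω (a : T) => h ω a.1.1 a.1.2.1 a.1.2.2) ≪ (volume : Measure (T → ℂ))) :
    ∀ᵐ ω ∂P, SecureDoFAchievable (h ω) (((K : ℝ) - 1) / (2 * K)) := by
  filter_upwards [ae_exists_alignment P h h_meas h_cont] with ω hω
  exact secureDoFAchievable_of_alignments hK hω
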